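/- Let $X$ be an infinite compact metrizable space and let $\sigma : X \to X$ be a minimal homeomorphism (no closed sets $E$ with $\sigma(E)=E$ besides $\emptyset$ and $X$). Let $A = \mathrm{C}(X)\rtimes_\sigma \mathbb{Z}$ be the crossed product C*-algebra, i.e. the universal C*-algebra generated by $\mathrm{C}(X)$ and a (canonical) unitary $u$ subject to $u f u^* = f\circ\sigma^{-1}$ for $f \in \mathrm{C}(X)$. For a closed set $Y \subseteq X$ put $$A_Y = \mathrm{C}^*\{f,\ ug \;;\; f, g \in \mathrm{C}(X),\ g|_Y = 0\} \subseteq A .$$ A C*-algebra $S$ is subhomogeneous if its irreducible representations are finite dimensional with bounded dimensions; its dimension ratio is then $$\mathrm{dimRatio}(S) = \max_{d}\ \frac{\dim \mathrm{Prim}_d(S)}{d},$$ where $d$ runs over the dimensions of the irreducible representations of $S$, $\mathrm{Prim}_d(S)$ is the set of kernels of $d$-dimensional irreducible representations with the hull-kernel topology, and $\dim$ is the topological covering dimension. Let $y \in X$, let $W$ be an open set containing $y$, and let $f_1,\dots,f_n,g_1,\dots,g_m \in \mathrm{C}(X)$ be such that every $g_j$ vanishes on $W$. Then for every $\varepsilon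 > 0$ there is $R > 0$ such that for every $J \in \mathbb{N}$ there are a closed neighborhood $Y$ of $y$ with $Y \subseteq W$ and a subhomogeneous unital sub-C*-algebra $S \subseteq A_Y$ such that 1. each element of $\{f_1,\dots,f_n, ug_1,\dots,ug_m\}$ is at norm distance less than $\varepsilon$ from some element of $S$; 2. $\mathrm{dimRatio}(S) \le R$; 3. every irreducible representation of $S$ has dimension at least $J$. -/

import Mathlib

open scoped ENNReal Topology

universe u

noncomputable section

/-! ### The crossed product of `C(X)` by a homeomorphism -/

section CrossedProduct

variable {X : Type u} [TopologicalSpace X]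

/-- A homeomorphism is minimal if it has no invariant closed sets besides `∅` and `X`. -/
def IsMinimalHomeo (σ : X ≃ₜ X) : Prop :=
  ∀ E : Set X, IsClosed E → σ '' E = E → E = ∅ ∨ E = Set.univ

/-- The automorphism `f ↦ f ∘ σ⁻¹` of `C(X)`, as a function. -/
def transl (σ : X ≃ₜ X) (f : C(X, ℂ)) : C(X, ℂ) :=
  f.comp ⟨σ.symm, σ.symm.continuous⟩

/-- A covariant representation of `(X, σ)` in a nonzero unital C*-algebra `B`: a unital
`*`-homomorphism `π : C(X) → B` and a unitary `U` of `B` such that `U π(f) U* = π(f ∘ σ⁻¹)`. -/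
structure CovariantRep (σ : X ≃ₜ X) : Type (u + 1) where
  B : Type u
  [cstar : CStarAlgebra B]
  [nontrivial : Nontrivial B]
  π : C(X, ℂ) →⋆ₐ[ℂ] B
  U : B
  unitary_mem : U ∈ unitary B
  covariant : ∀ f : C(X, ℂ), U * π f * star U = π (transl σ f)

instance (σ : X ≃ₜ X) (c : CovariantRep σ) : CStarAlgebra c.B := c.cstar
instance (σ : X ≃ₜ X) (c : CovariantRep σ) : Nontrivial c.B := c.nontrivial

instance instCStarAlgebraLp {I : Type*} {A : I → Type*} [∀ i, Nontrivial (A i)]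
    [∀ i, CStarAlgebra (A i)] : CStarAlgebra (lp A ∞) where

/-- The C*-algebra of bounded families `(b_c)`, indexed by all covariant representations `c`,
with `b_c` in the target algebra of `c`. -/
abbrev CovariantProd (σ : X ≃ₜ X) : Type (u + 1) := lp (fun c : CovariantRep σ => c.B) ∞

variable [CompactSpace X]

/-- The family `(π_c(f))_c`. -/
def famFun (σ : X ≃ₜ X) (f : C(X, ℂ)) : CovariantProd σ :=
  ⟨fun c => c.π f, memℓp_infty ⟨‖f‖, by
    rintro _ ⟨c, rfl⟩
    exact NonUnitalStarAlgHom.norm_apply_le c.π f⟩⟩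

/-- The family `(U_c)_c`. -/
def famU (σ : X ≃ₜ X) : CovariantProd σ :=
  ⟨fun c => c.U, memℓp_infty ⟨1, by
    rintro _ ⟨c, rfl⟩
    exact (CStarRing.norm_of_mem_unitary c.unitary_mem).le⟩⟩

/-- The closed unital `*`-subalgebra generated by the families `(π_c(f))_c` and `(U_c)_c`. -/
def crossedSubalgebra (σ : X ≃ₜ X) : StarSubalgebra ℂ (CovariantProd σ) :=
  (StarAlgebra.adjoin ℂ (Set.range (famFun σ) ∪ {famU σ})).topologicalClosure

/-- The (full) crossed product `C(X) ⋊_σ ℤ`: the universal C*-algebra generated by `C(X)` and a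
unitary `u` with `u f u* = f ∘ σ⁻¹`.  It is built as the C*-algebra generated by the universal
covariant pair in the product of all covariant representations, so that the norm of a polynomial
in `f` and `u` is the supremum of its norms in all covariant representations.
Its universal property is `CrossedProduct.existsUnique_lift` below. -/
abbrev CrossedProduct (σ : X ≃ₜ X) : Type (u + 1) := crossedSubalgebra σ

namespace CrossedProduct

instance (σ : X ≃ₜ X) : IsClosed (crossedSubalgebra σ : Set (CovariantProd σ)) :=
  StarSubalgebra.isClosed_topologicalClosure _

instance (σ : X ≃ₜ X) : CStarAlgebra (CrossedProduct σ) := inferInstance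

/-- The canonical `*`-homomorphism `C(X) → C(X) ⋊_σ ℤ`. -/
def ofFun (σ : X ≃ₜ X) : C(X, ℂ) →⋆ₐ[ℂ] CrossedProduct σ where
  toFun f := ⟨famFun σ f, StarSubalgebra.le_topologicalClosure _
    (StarAlgebra.subset_adjoin ℂ _ (Or.inl ⟨f, rfl⟩))⟩
  map_one' := Subtype.ext <| Subtype.ext <| funext fun c => map_one c.π
  map_mul' f g := Subtype.ext <| Subtype.ext <| funext fun c => map_mul c.π f g
  map_zero' := Subtype.ext <| Subtype.ext <| funext fun c => map_zero c.π
  map_add' f g := Subtype.ext <| Subtype.ext <| funext fun c => map_add c.π f g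
  commutes' r := Subtype.ext <| Subtype.ext <| funext fun c => AlgHomClass.commutes c.π r
  map_star' f := Subtype.ext <| Subtype.ext <| funext fun c => map_star c.π f

/-- The canonical unitary of `C(X) ⋊_σ ℤ`. -/
def u (σ : X ≃ₜ X) : CrossedProduct σ :=
  ⟨famU σ, StarSubalgebra.le_topologicalClosure _ (StarAlgebra.subset_adjoin ℂ _ (Or.inr rfl))⟩

/-- Evaluation at one covariant representation. -/
def lift {σ : X ≃ₜ X} (c : CovariantRep σ) : CrossedProduct σ →⋆ₐ[ℂ] c.B where
  toFun a := a.1 c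
  map_one' := rfl
  map_mul' _ _ := rfl
  map_zero' := rfl
  map_add' _ _ := rfl
  commutes' _ := rfl
  map_star' _ := rfl

theorem u_mem_unitary (σ : X ≃ₜ X) : u σ ∈ unitary (CrossedProduct σ) :=
  ⟨Subtype.ext <| Subtype.ext <| funext fun c => c.unitary_mem.1,
    Subtype.ext <| Subtype.ext <| funext fun c => c.unitary_mem.2⟩

theorem covariant (σ : X ≃ₜ X) (f : C(X, ℂ)) :
    u σ * ofFun σ f * star (u σ) = ofFun σ (transl σ f) :=
  Subtype.ext <| Subtype.ext <| funext fun c => c.covariant f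

theorem existsUnique_lift {σ : X ≃ₜ X} (c : CovariantRep σ) :
    ∃! φ : CrossedProduct σ →⋆ₐ[ℂ] c.B, (∀ f, φ (ofFun σ f) = c.π f) ∧ φ (u σ) = c.U := by
  refine ⟨lift c, ⟨fun _ => rfl, rfl⟩, ?_⟩
  rintro φ ⟨h1, h2⟩
  refine StarAlgHom.ext_topologicalClosure (φ := φ) (ψ := lift c)
    (S := StarAlgebra.adjoin ℂ (Set.range (famFun σ) ∪ {famU σ})) ?_ ?_ ?_
  · exact AddMonoidHomClass.continuous_of_bound φ 1 fun a => by
      simpa using NonUnitalStarAlgHom.norm_apply_le φ a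
  · exact AddMonoidHomClass.continuous_of_bound (lift c) 1 fun a => by
      simpa using NonUnitalStarAlgHom.norm_apply_le (lift c) a
  · refine StarAlgHom.ext_adjoin (fun a ha => ?_)
    obtain ⟨a, ha'⟩ := a
    rcases ha with ⟨f, rfl⟩ | rfl
    · exact h1 f
    · exact h2

/-- The subalgebra `A_Y = C*{f, ug ; f, g ∈ C(X), g|_Y = 0}` of `A = C(X) ⋊_σ ℤ`. -/
def orbitBreaking (σ : X ≃ₜ X) (Y : Set X) : StarSubalgebra ℂ (CrossedProduct σ) :=
  (StarAlgebra.adjoin ℂ (Set.range (ofFun σ) ∪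
    {a | ∃ g : C(X, ℂ), (∀ x ∈ Y, g x = 0) ∧ a = u σ * ofFun σ g})).topologicalClosure

end CrossedProduct

end CrossedProduct

/-! ### Covering dimension -/

section CoveringDimension

variable (T : Type*) [TopologicalSpace T]

/-- `dim T ≤ n`: every finite open cover has a finite open refinement of order at most `n`,
that is, no point lies in more than `n + 1` of its members. -/
def CoveringDimLE (n : ℕ) : Prop :=
  ∀ (ι : Type) [Finite ι] (V : ι → Set T), (∀ i, IsOpen (V i)) → (⋃ i, V i) = Set.univ →
    ∃ (κ : Type) (_ : Finite κ) (W : κ → Set T),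
      (∀ k, IsOpen (W k)) ∧ (⋃ k, W k) = Set.univ ∧ (∀ k, ∃ i, W k ⊆ V i) ∧
      ∀ x, {k | x ∈ W k}.ncard ≤ n + 1

/-- The topological covering dimension of a (nonempty) space; it is `⊤` if no `n` bounds it. -/
def coveringDim : ℕ∞ := ⨅ (n : ℕ) (_ : CoveringDimLE T n), (n : ℕ∞)

end CoveringDimension

/-! ### Irreducible representations, primitive ideals, and the dimension ratio -/

section Representations

variable (S : Type u) [NonUnitalRing S] [StarRing S] [Module ℂ S]

/-- An irreducible representation of a C*-algebra `S`: a nonzero `*`-homomorphism `π : S → B(H)`,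
with `H` a Hilbert space, such that `H` has no closed `π(S)`-invariant subspaces besides `0` and
`H`.  (Every irreducible representation of `S` is unitarily equivalent to one on a Hilbert space in
the universe of `S`, because it is a quotient of `S` as a vector space.) -/
structure IrrRep : Type (u + 1) where
  H : Type u
  [normed : NormedAddCommGroup H]
  [inner : InnerProductSpace ℂ H]
  [complete : CompleteSpace H]
  π : S →⋆ₙₐ[ℂ] (H →L[ℂ] H)
  ne_zero : π ≠ 0
  irreducible : ∀ K : Submodule ℂ H, IsClosed (K : Set H) →
    (∀ a : S, ∀ v ∈ K, π a v ∈ K) → K = ⊥ ∨ K = ⊤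

attribute [instance] IrrRep.normed IrrRep.inner IrrRep.complete

variable {S}

/-- The irreducible representation `ρ` has (finite) dimension `d`. -/
def IrrRep.HasDim (ρ : IrrRep S) (d : ℕ) : Prop :=
  FiniteDimensional ℂ ρ.H ∧ Module.finrank ℂ ρ.H = d

/-- The kernel of an irreducible representation, a primitive ideal of `S`. -/
def IrrRep.ker (ρ : IrrRep S) : TwoSidedIdeal S := TwoSidedIdeal.ker ρ.π

variable (S)

/-- A C*-algebra is subhomogeneous if its irreducible representations are finite dimensional, of
bounded dimension. -/
def IsSubhomogeneous : Prop :=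
  ∃ N : ℕ, ∀ ρ : IrrRep S, ∃ d ≤ N, ρ.HasDim d

/-- The primitive ideal space of `S`, as a set. -/
def Prim : Type u := {P : TwoSidedIdeal S // ∃ ρ : IrrRep S, ρ.ker = P}

/-- The hull-kernel (Jacobson) topology.  Its open sets are the sets `{P | ¬ I ⊆ P}` with `I` an
ideal; such a set is the union of the sets `{P | a ∉ P}` with `a ∈ I`. -/
instance : TopologicalSpace (Prim S) :=
  TopologicalSpace.generateFrom {O | ∃ a : S, O = {P : Prim S | a ∉ P.1}}

/-- `Prim_d(S)`: the primitive ideals that are kernels of `d`-dimensional irreducible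
representations, with the topology of the subspace of `Prim S`. -/
def primOfDim (d : ℕ) : Set (Prim S) :=
  {P | ∃ ρ : IrrRep S, ρ.HasDim d ∧ ρ.ker = P.1}

/-- The dimension ratio of a subhomogeneous C*-algebra: the maximum of `dim (Prim_d(S)) / d` over
the (finitely many) dimensions `d` of irreducible representations of `S`. -/
def dimRatio : ℝ≥0∞ :=
  ⨆ (d : ℕ) (_ : ∃ ρ : IrrRep S, ρ.HasDim d), (coveringDim (primOfDim S d) : ℝ≥0∞) / (d : ℝ≥0∞)

end Representations

end

/-!
Call `uⁿ a` with `a ∈ C(X)` homogeneous of degree `n`. Let `h` be a function whose zero set `Y` is a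
closed neighbourhood of `y` inside `W`, with `h = 1` off `W`, and let `S` be generated by the `fᵢ`,
the `gⱼ`, `h` and `u h`; it contains `u gⱼ = u h gⱼ` exactly. Homogeneous elements span a dense
subspace of `S`. By minimality and compactness every orbit enters `Y` within a bounded time, which
bounds the degrees of these elements, so an irreducible representation has a lowest weight vector,
on which the degree zero part acts by evaluation at a point `x`. Moving this vector up by `u h`
until the orbit of `x` enters `Y` yields an orthonormal basis indexed by the orbit segment `x, σ x,
…, σ^δ x` between two consecutive visits to `Y`, and the representation is determined by the values
on this segment of the `q = n + m + 1` generating functions. Hence dimensions of irreducible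
representations are return times to `Y`, which are at least `J` once `Y` is small, while `Prim_d`
embeds into `ℂ^(q d)`. The covering dimension of the latter grows linearly in `d`, so the dimension
ratio is at most `2 q`, whatever `ε` and `J` are.
-/

/-! ### The covering dimension of subspaces of `ℂ^κ` -/

section ZeroDimensional

variable {T ι : Type*} [TopologicalSpace T]

/-- Disjoint closed sets are separated by a clopen set: the large inductive dimension of `T` is at
most zero. -/
def IndLEZero (T : Type*) [TopologicalSpace T] : Prop :=
  ∀ A B : Set T, IsClosed A → IsClosed B → Disjoint A B →
    ∃ C : Set T, IsClopen C ∧ A ⊆ C ∧ Disjoint C B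

theorem exists_isLocallyConstant_mem_of_isClopen [Countable ι] {C : ι → Set T}
    (hC : ∀ i, IsClopen (C i)) (hCU : ⋃ i, C i = Set.univ) :
    ∃ ν : T → ι, IsLocallyConstant ν ∧ ∀ x, x ∈ C (ν x) := by
  obtain ⟨e, he⟩ := exists_injective_nat ι
  have exists_first (x : T) : ∃ i, x ∈ C i ∧ ∀ j, e j < e i → x ∉ C j := by
    obtain ⟨i, hi, hmin⟩ := exists_minimalFor_of_wellFoundedLT (x ∈ C ·) e
      (Set.mem_iUnion.mp (hCU ▸ Set.mem_univ x))
    exact ⟨i, hi, fun j hj hx => hj.not_ge (hmin hx hj.le)⟩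
  choose ν hν hfirst using exists_first
  refine ⟨ν, (IsLocallyConstant.iff_isOpen_fiber).mpr fun i => ?_, hν⟩
  have fiber_eq : ν ⁻¹' {i} = C i \ ⋃ j ∈ {j | e j < e i}, C j := by
    ext x
    simp only [Set.mem_preimage, Set.mem_singleton_iff, Set.mem_sdiff, Set.mem_iUnion,
      Set.mem_ofPred_eq, exists_prop, not_exists, not_and]
    constructor
    · rintro rfl
      exact ⟨hν x, hfirst x⟩
    · rintro ⟨hx, hi⟩
      exact he (le_antisymm (not_lt.mp fun h => hfirst x i h hx) (not_lt.mp fun h => hi _ h (hν x)))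
  rw [fiber_eq]
  exact (hC i).isOpen.sdiff <| Set.Finite.isClosed_biUnion
    ((Set.finite_lt_nat (e i)).preimage he.injOn) fun j _ => (hC j).isClosed

theorem exists_isClosed_superset_subset_interior [NormalSpace T] {A B : Set T} (hA : IsClosed A)
    (hB : IsClosed B) (hAB : Disjoint A B) :
    ∃ A' B' : Set T, IsClosed A' ∧ IsClosed B' ∧ Disjoint A' B' ∧
      A ⊆ interior A' ∧ B ⊆ interior B' := by
  obtain ⟨U, hU, hAU, hUB⟩ := normal_exists_closure_subset hA hB.isOpen_compl
    (Set.subset_compl_iff_disjoint_right.mpr hAB)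
  obtain ⟨V, hV, hBV, hVU⟩ := normal_exists_closure_subset hB
    (isClosed_closure (s := U)).isOpen_compl (Set.subset_compl_comm.mp hUB)
  exact ⟨closure U, closure V, isClosed_closure, isClosed_closure,
    (Set.subset_compl_iff_disjoint_right.mp hVU).symm,
    hAU.trans (interior_maximal subset_closure hU), hBV.trans (interior_maximal subset_closure hV)⟩

namespace IndLEZero

theorem of_clopen_nhds [SecondCountableTopology T]
    (h : ∀ x : T, ∀ U ∈ 𝓝 x, ∃ C : Set T, IsClopen C ∧ x ∈ C ∧ C ⊆ U) : IndLEZero T := by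
  intro A B hA hB hAB
  have exists_nhd (x : T) : ∃ C : Set T, IsClopen C ∧ x ∈ C ∧ (Disjoint C A ∨ Disjoint C B) := by
    by_cases hx : x ∈ A
    · obtain ⟨C, hC, hxC, hCB⟩ := h x Bᶜ
        (hB.isOpen_compl.mem_nhds (Set.disjoint_left.mp hAB hx))
      exact ⟨C, hC, hxC, Or.inr (Set.subset_compl_iff_disjoint_right.mp hCB)⟩
    · obtain ⟨C, hC, hxC, hCA⟩ := h x Aᶜ (hA.isOpen_compl.mem_nhds hx)
      exact ⟨C, hC, hxC, Or.inl (Set.subset_compl_iff_disjoint_right.mp hCA)⟩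
  choose C hC hxC hCd using exists_nhd
  obtain ⟨s, hs, hsU⟩ := TopologicalSpace.countable_cover_nhds
    fun x => (hC x).isOpen.mem_nhds (hxC x)
  have := hs.to_subtype
  obtain ⟨ν, hν, hνC⟩ := exists_isLocallyConstant_mem_of_isClopen (fun x : s => hC x)
    ((Set.iUnion_subtype _ _).trans hsU)
  refine ⟨ν ⁻¹' {x | Disjoint (C x) B}, ⟨isOpen_compl_iff.mp (hν {x | Disjoint (C x) B}ᶜ), hν _⟩,
    fun x hx => ?_, ?_⟩
  · exact (hCd (ν x)).resolve_left fun hd => Set.disjoint_left.mp hd (hνC x) hx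
  · exact Set.disjoint_left.mpr fun x hx hxB => Set.disjoint_left.mp hx (hνC x) hxB

theorem exists_isLocallyConstant_mem [NormalSpace T] (hT : IndLEZero T) [Finite ι]
    {V : ι → Set T} (hV : ∀ i, IsOpen (V i)) (hVU : ⋃ i, V i = Set.univ) :
    ∃ ν : T → ι, IsLocallyConstant ν ∧ ∀ x, x ∈ V (ν x) := by
  obtain ⟨K, hKU, hK, hKV⟩ := exists_iUnion_eq_closed_subset hV (fun x => Set.toFinite _) hVU
  choose C hC hKC hCV using fun i => hT (K i) (V i)ᶜ (hK i) (hV i).isClosed_compl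
    (Set.disjoint_compl_right_iff_subset.mpr (hKV i))
  obtain ⟨ν, hν, hνC⟩ := exists_isLocallyConstant_mem_of_isClopen hC
    (Set.univ_subset_iff.mp (hKU ▸ Set.iUnion_mono hKC))
  exact ⟨ν, hν, fun x => Set.disjoint_compl_right_iff_subset.mp (hCV _) (hνC x)⟩

theorem exists_isClosed_superset_of_subtype [NormalSpace T] {F : Set T} (hF : IsClosed F)
    (h : IndLEZero F) {A B : Set T} (hA : IsClosed A) (hB : IsClosed B) (hAB : Disjoint A B) :
    ∃ A' B' : Set T, IsClosed A' ∧ IsClosed B' ∧ Disjoint A' B' ∧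
      A ⊆ interior A' ∧ B ⊆ interior B' ∧ F ⊆ A' ∪ B' := by
  obtain ⟨C, hC, hAC, hCB⟩ := h (Subtype.val ⁻¹' A) (Subtype.val ⁻¹' B)
    (hA.preimage continuous_subtype_val) (hB.preimage continuous_subtype_val) (hAB.preimage _)
  have isClosed_image {D : Set F} (hD : IsClosed D) : IsClosed (Subtype.val '' D) :=
    hF.isClosedEmbedding_subtypeVal.isClosedMap D hD
  have disj : Disjoint (A ∪ Subtype.val '' C) (B ∪ Subtype.val '' Cᶜ) := by
    simp only [Set.disjoint_union_left, Set.disjoint_union_right,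
      Set.disjoint_image_iff Subtype.val_injective]
    refine ⟨⟨hAB, ?_⟩, ?_, disjoint_compl_right⟩
    · exact Set.disjoint_image_left.mpr hCB
    · exact (Set.disjoint_image_left.mpr (Set.disjoint_compl_left_iff_subset.mpr hAC)).symm
  obtain ⟨A', B', hA', hB', hd, hAA', hBB'⟩ := exists_isClosed_superset_subset_interior
    (hA.union (isClosed_image hC.isClosed)) (hB.union (isClosed_image hC.compl.isClosed)) disj
  refine ⟨A', B', hA', hB', hd, Set.subset_union_left.trans hAA', Set.subset_union_left.trans hBB',
    fun x hx => ?_⟩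
  by_cases hxC : ⟨x, hx⟩ ∈ C
  · exact Or.inl (interior_subset (hAA' (Or.inr ⟨_, hxC, rfl⟩)))
  · exact Or.inr (interior_subset (hBB' (Or.inr ⟨_, hxC, rfl⟩)))

/-- Enlarge the two sets step by step, absorbing `F n` at the `n`-th step. -/
theorem of_iUnion_isClosed [NormalSpace T] {F : ℕ → Set T} (hF : ∀ n, IsClosed (F n))
    (hFU : ⋃ n, F n = Set.univ) (h : ∀ n, IndLEZero (F n)) : IndLEZero T := by
  intro A B hA hB hAB
  let Q := {q : Set T × Set T // IsClosed q.1 ∧ IsClosed q.2 ∧ Disjoint q.1 q.2}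
  have step (n : ℕ) (q : Q) : ∃ r : Q, q.1.1 ⊆ interior r.1.1 ∧ q.1.2 ⊆ interior r.1.2 ∧
      F n ⊆ r.1.1 ∪ r.1.2 := by
    obtain ⟨A', B', hA', hB', hd, hr⟩ :=
      exists_isClosed_superset_of_subtype (hF n) (h n) q.2.1 q.2.2.1 q.2.2.2
    exact ⟨⟨(A', B'), hA', hB', hd⟩, hr⟩
  choose next hnext₁ hnext₂ hnextF using step
  let q : ℕ → Q := fun n => n.rec ⟨(A, B), hA, hB, hAB⟩ next
  have isOpen_iUnion_of_succ {D : ℕ → Set T} (hD : ∀ n, D n ⊆ interior (D (n + 1))) :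
      IsOpen (⋃ n, D n) := by
    have iUnion_eq : ⋃ n, D n = ⋃ n, interior (D n) :=
      (Set.iUnion_subset fun n => (hD n).trans <|
        Set.subset_iUnion (fun n => interior (D n)) (n + 1)).antisymm
        (Set.iUnion_mono fun n => interior_subset)
    exact iUnion_eq ▸ isOpen_iUnion fun n => isOpen_interior
  have mono₁ : Monotone fun n => (q n).1.1 :=
    monotone_nat_of_le_succ fun n => (hnext₁ n (q n)).trans interior_subset
  have mono₂ : Monotone fun n => (q n).1.2 :=
    monotone_nat_of_le_succ fun n => (hnext₂ n (q n)).trans interior_subset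
  have disj : Disjoint (⋃ n, (q n).1.1) (⋃ n, (q n).1.2) := by
    simp only [Set.disjoint_iUnion_left, Set.disjoint_iUnion_right]
    exact fun i j => (q (max i j)).2.2.2.mono (mono₁ (le_max_right i j)) (mono₂ (le_max_left i j))
  have cover : (⋃ n, (q n).1.1) ∪ ⋃ n, (q n).1.2 = Set.univ := by
    rw [← Set.iUnion_union_distrib, ← Set.univ_subset_iff, ← hFU]
    exact Set.iUnion_subset fun n => (hnextF n (q n)).trans (Set.subset_iUnion
      (fun n => (q n).1.1 ∪ (q n).1.2) (n + 1))
  refine ⟨⋃ n, (q n).1.1, ⟨?_, isOpen_iUnion_of_succ fun n => hnext₁ n (q n)⟩,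
    Set.subset_iUnion (fun n => (q n).1.1) 0,
    disj.mono_right (Set.subset_iUnion (fun n => (q n).1.2) 0)⟩
  rw [← isOpen_compl_iff, IsCompl.compl_eq ⟨disj, codisjoint_iff.mpr cover⟩]
  exact isOpen_iUnion_of_succ fun n => hnext₂ n (q n)

end IndLEZero

end ZeroDimensional

section CoveringDimensionBound

variable {T ι κ : Type*} [TopologicalSpace T]

theorem exists_disjoint_open_extension {M : Type*} [PseudoMetricSpace M]
    {D : Set M} {ν : D → ι} (hν : IsLocallyConstant ν) :
    ∃ W : ι → Set M, (∀ i, IsOpen (W i)) ∧ Pairwise (Function.onFun Disjoint W) ∧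
      ∀ x : D, ↑x ∈ W (ν x) := by
  let near (i : ι) : Set M := Subtype.val '' (ν ⁻¹' {i})
  let far (i : ι) : Set M := Subtype.val '' (ν ⁻¹' {i}ᶜ)
  refine ⟨fun i => {z | Metric.infEDist z (near i) < Metric.infEDist z (far i)}, fun i =>
    isOpen_lt Metric.continuous_infEDist Metric.continuous_infEDist, fun i j hij => ?_,
    fun x => ?_⟩
  · have near_subset_far {k l : ι} (hkl : k ≠ l) : near k ⊆ far l :=
      Set.image_mono (Set.preimage_mono (Set.singleton_subset_iff.mpr hkl))
    refine Set.disjoint_left.mpr fun z hi hj => lt_irrefl (Metric.infEDist z (near i)) ?_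
    calc Metric.infEDist z (near i) < Metric.infEDist z (far i) := hi
      _ ≤ Metric.infEDist z (near j) := Metric.infEDist_anti (near_subset_far hij.symm)
      _ < Metric.infEDist z (far j) := hj
      _ ≤ Metric.infEDist z (near i) := Metric.infEDist_anti (near_subset_far hij)
  · have notMem_closure : (x : M) ∉ closure (far (ν x)) := by
      rw [← closure_subtype]
      exact fun h => (hν {ν x}).isClosed_compl.closure_subset h rfl
    have mem_near : (x : M) ∈ near (ν x) := ⟨x, rfl, rfl⟩
    rw [Set.mem_ofPred_eq, Metric.infEDist_zero_of_mem mem_near, pos_iff_ne_zero]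
    exact fun h => notMem_closure (Metric.mem_closure_iff_infEDist_zero.mpr h)

theorem IndLEZero.exists_disjoint_open_refinement [TopologicalSpace.PseudoMetrizableSpace T]
    {D : Set T} (hD : IndLEZero D) [Finite ι] {V : ι → Set T} (hV : ∀ i, IsOpen (V i))
    (hDV : D ⊆ ⋃ i, V i) :
    ∃ W : ι → Set T, (∀ i, IsOpen (W i)) ∧ (∀ i, W i ⊆ V i) ∧
      Pairwise (Function.onFun Disjoint W) ∧ D ⊆ ⋃ i, W i := by
  let := TopologicalSpace.pseudoMetrizableSpacePseudoMetric T
  obtain ⟨ν, hν, hνV⟩ := hD.exists_isLocallyConstant_mem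
    (V := fun i => Subtype.val ⁻¹' V i) (fun i => (hV i).preimage continuous_subtype_val)
    (by rwa [← Set.preimage_iUnion, Set.preimage_eq_univ_iff, Subtype.range_coe])
  obtain ⟨W, hW, hWd, hνW⟩ := exists_disjoint_open_extension hν
  exact ⟨fun i => W i ∩ V i, fun i => (hW i).inter (hV i), fun i => Set.inter_subset_right,
    fun i j hij => (hWd hij).mono Set.inter_subset_left Set.inter_subset_left,
    fun x hx => Set.mem_iUnion.mpr ⟨ν ⟨x, hx⟩, hνW ⟨x, hx⟩, hνV ⟨x, hx⟩⟩⟩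

theorem coveringDimLE_of_disjoint_open_refinements {n : ℕ} {D : Fin (n + 1) → Set T}
    (hDU : ⋃ j, D j = Set.univ)
    (h : ∀ j, ∀ (ι : Type) [Finite ι] (V : ι → Set T), (∀ i, IsOpen (V i)) →
      (⋃ i, V i) = Set.univ → ∃ W : ι → Set T, (∀ i, IsOpen (W i)) ∧ (∀ i, W i ⊆ V i) ∧
        Pairwise (Function.onFun Disjoint W) ∧ D j ⊆ ⋃ i, W i) :
    CoveringDimLE T n := by
  intro ι _ V hV hVU
  choose W hW hWV hWd hDW using fun j => h j ι V hV hVU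
  refine ⟨Fin (n + 1) × ι, inferInstance, fun k => W k.1 k.2, fun k => hW k.1 k.2, ?_,
    fun k => ⟨k.2, hWV k.1 k.2⟩, fun x => ?_⟩
  · rw [← Set.univ_subset_iff, ← hDU, Set.iUnion_prod']
    exact Set.iUnion_mono hDW
  · have fst_injOn : Set.InjOn Prod.fst {k : Fin (n + 1) × ι | x ∈ W k.1 k.2} := by
      rintro ⟨j, i⟩ hi ⟨_, i'⟩ hi' rfl
      by_contra hne
      exact Set.disjoint_left.mp (hWd j fun h => hne (congrArg (Prod.mk j) h)) hi hi'
    calc {k : Fin (n + 1) × ι | x ∈ W k.1 k.2}.ncard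
        = (Prod.fst '' {k : Fin (n + 1) × ι | x ∈ W k.1 k.2}).ncard := fst_injOn.ncard_image.symm
      _ ≤ (Set.univ : Set (Fin (n + 1))).ncard := Set.ncard_le_ncard (Set.subset_univ _)
      _ = n + 1 := by rw [Set.ncard_univ, Nat.card_fin]

variable [Finite κ]

theorem IndLEZero.of_isInducing {p : T → κ → ℝ} (hp : Topology.IsInducing p)
    (h : ∀ i, (∃ c, ∀ z, p z i = c) ∨ ∀ z, Irrational (p z i)) : IndLEZero T := by
  have := hp.secondCountableTopology
  have := Fintype.ofFinite κ
  have continuous_coord (i : κ) : Continuous fun z => p z i :=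
    (continuous_apply i).comp hp.continuous
  have isClopen_rat_box (i : κ) (a b : ℚ) : IsClopen {z | p z i ∈ Set.Ioo (a : ℝ) b} := by
    refine ⟨?_, isOpen_Ioo.preimage (continuous_coord i)⟩
    rcases h i with ⟨c, hc⟩ | hirr
    · simp only [hc]
      exact isClosed_const
    · have Ioo_eq_Icc : {z | p z i ∈ Set.Ioo (a : ℝ) b} = {z | p z i ∈ Set.Icc (a : ℝ) b} :=
        Set.ext fun z => ⟨fun hz => Set.Ioo_subset_Icc_self hz, fun hz =>
          ⟨hz.1.lt_of_ne fun he => hirr z ⟨a, he⟩, hz.2.lt_of_ne fun he => hirr z ⟨b, he.symm⟩⟩⟩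
      exact Ioo_eq_Icc ▸ isClosed_Icc.preimage (continuous_coord i)
  refine IndLEZero.of_clopen_nhds fun x U hU => ?_
  rw [hp.nhds_eq_comap, Filter.mem_comap] at hU
  obtain ⟨V, hV, hVU⟩ := hU
  obtain ⟨δ, hδ, hball⟩ := Metric.mem_nhds_iff.mp hV
  choose a ha hax using fun i => exists_rat_btwn (sub_lt_self (p x i) hδ)
  choose b hxb hb using fun i => exists_rat_btwn (lt_add_of_pos_right (p x i) hδ)
  refine ⟨⋂ i, {z | p z i ∈ Set.Ioo (a i : ℝ) (b i)},
    isClopen_iInter_of_finite fun i => isClopen_rat_box i (a i) (b i),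
    Set.mem_iInter.mpr fun i => ⟨hax i, hxb i⟩, fun z hz => hVU (hball ?_)⟩
  rw [Metric.mem_ball, dist_pi_lt_iff hδ]
  intro i
  have mem_Ioo := Set.mem_iInter.mp hz i
  rw [Real.dist_eq, abs_sub_lt_iff]
  exact ⟨by linarith [mem_Ioo.2, hb i], by linarith [mem_Ioo.1, ha i]⟩

/-- The set is the countable union of the closed pieces on which the rational coordinates and their
values are prescribed. -/
theorem indLEZero_setOf_ncard_rational_eq {p : T → κ → ℝ} (hp : Topology.IsInducing p) (j : ℕ) :
    IndLEZero {z | {i | ¬ Irrational (p z i)}.ncard = j} := by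
  have := hp.pseudoMetrizableSpace
  set D := {z | {i | ¬ Irrational (p z i)}.ncard = j}
  have hpD : Topology.IsInducing fun z : D => p z := hp.comp Topology.IsInducing.subtypeVal
  obtain ⟨e, he⟩ := exists_surjective_nat (Set κ × (κ → ℚ))
  refine IndLEZero.of_iUnion_isClosed
    (F := fun n => {z : D | (e n).1.ncard = j ∧ ∀ i ∈ (e n).1, p z i = (e n).2 i})
    (fun n => ?_) (Set.eq_univ_of_forall fun z => Set.mem_iUnion.mpr ?_) fun n => ?_
  · simp only [Set.ofPred_and, Set.ofPred_forall]
    exact isClosed_const.inter (isClosed_iInter fun i => isClosed_iInter fun _ =>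
      isClosed_eq ((continuous_apply i).comp hpD.continuous) continuous_const)
  · choose q hq using fun i : {i | ¬ Irrational (p z i)} => not_not.mp i.2
    classical
    obtain ⟨n, hn⟩ := he ({i | ¬ Irrational (p z i)},
      fun i => if hi : ¬ Irrational (p z i) then q ⟨i, hi⟩ else 0)
    refine ⟨n, ?_⟩
    simp only [Set.mem_ofPred_eq, hn]
    exact ⟨z.2, fun i hi => by rw [dif_pos hi, hq ⟨i, hi⟩]⟩
  · refine IndLEZero.of_isInducing (hpD.comp Topology.IsInducing.subtypeVal) fun i => ?_
    by_cases hi : i ∈ (e n).1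
    · exact Or.inl ⟨(e n).2 i, fun z => z.2.2 i hi⟩
    · refine Or.inr fun z => not_not.mp fun hz => hi ?_
      have rational_eq : (e n).1 = {i | ¬ Irrational (p z i)} :=
        Set.eq_of_subset_of_ncard_le (fun k hk hirr => hirr ⟨_, (z.2.2 k hk).symm⟩)
          (z.1.2.trans z.2.1.symm).le (Set.toFinite _)
      exact rational_eq ▸ hz

theorem coveringDimLE_of_isInducing_real {p : T → κ → ℝ} (hp : Topology.IsInducing p) :
    CoveringDimLE T (Nat.card κ) := by
  have := hp.pseudoMetrizableSpace
  refine coveringDimLE_of_disjoint_open_refinements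
    (D := fun j => {z | {i | ¬ Irrational (p z i)}.ncard = j})
    (Set.eq_univ_of_forall fun z => Set.mem_iUnion.mpr
      ⟨⟨{i | ¬ Irrational (p z i)}.ncard, Nat.lt_succ_of_le (Set.ncard_le_card _)⟩, rfl⟩)
    fun j ι _ V hV hVU => ?_
  exact (indLEZero_setOf_ncard_rational_eq hp j).exists_disjoint_open_refinement hV
    (hVU ▸ Set.subset_univ _)

theorem coveringDimLE_of_isInducing_complex {p : T → κ → ℂ} (hp : Topology.IsInducing p) :
    CoveringDimLE T (2 * Nat.card κ) := by
  let split (w : κ → ℂ) : κ ⊕ κ → ℝ := Sum.elim (fun i => (w i).re) fun i => (w i).im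
  have hsplit : Topology.IsEmbedding split := by
    refine Function.LeftInverse.isEmbedding (f := fun r i => ⟨r (.inl i), r (.inr i)⟩)
      (fun w => rfl) ?_ ?_
    · exact continuous_pi fun i =>
        Complex.equivRealProdCLM.symm.continuous.comp
          (f := fun r : κ ⊕ κ → ℝ => (r (Sum.inl i), r (Sum.inr i)))
          ((continuous_apply _).prodMk (continuous_apply _))
    · exact continuous_pi fun i => i.casesOn
        (fun i => Complex.continuous_re.comp (continuous_apply i))
        fun i => Complex.continuous_im.comp (continuous_apply i)
  simpa only [Nat.card_sum, ← two_mul] using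
    coveringDimLE_of_isInducing_real (hsplit.isInducing.comp hp)

end CoveringDimensionBound

noncomputable section

open scoped CStarAlgebra InnerProductSpace

/-! ### Homogeneous elements -/

section Shift

variable {X : Type*} [TopologicalSpace X] {σ : X ≃ₜ X} {Y : Set X} {n m : ℤ} {x : X}

theorem zpow_add_apply (σ : X ≃ₜ X) (n m : ℤ) (x : X) :
    (σ ^ (n + m)) x = (σ ^ n) ((σ ^ m) x) := by
  rw [zpow_add]; rfl

/-- The translate `a ∘ σⁿ` of a function `a`. -/
def shift (σ : X ≃ₜ X) (n : ℤ) (a : C(X, ℂ)) : C(X, ℂ) :=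
  a.comp ⟨(σ ^ n : X ≃ₜ X), (σ ^ n : X ≃ₜ X).continuous⟩

@[simp]
theorem shift_apply (σ : X ≃ₜ X) (n : ℤ) (a : C(X, ℂ)) (x : X) :
    shift σ n a x = a ((σ ^ n) x) := rfl

theorem shift_shift (σ : X ≃ₜ X) (n m : ℤ) (a : C(X, ℂ)) :
    shift σ n (shift σ m a) = shift σ (m + n) a :=
  ContinuousMap.ext fun x => congrArg a (zpow_add_apply σ m n x).symm

@[simp]
theorem shift_zero (σ : X ≃ₜ X) (a : C(X, ℂ)) : shift σ 0 a = a :=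
  ContinuousMap.ext fun x => by rw [shift_apply, zpow_zero]; rfl

/-- The points whose orbit segment from `x` to `σⁿ x` meets `Y`. The endpoint that is the later one
in the direction of `σ` does not count, so that a step from `x` to `σ x` crosses `Y` when
`x ∈ Y`. -/
def crossingSet (σ : X ≃ₜ X) (Y : Set X) (n : ℤ) : Set X :=
  {x | ∃ k ∈ Set.Ico (min 0 n) (max 0 n), (σ ^ k) x ∈ Y}

@[simp]
theorem crossingSet_zero (σ : X ≃ₜ X) (Y : Set X) : crossingSet σ Y 0 = ∅ := by
  simp [crossingSet]

@[simp]
theorem crossingSet_one (σ : X ≃ₜ X) (Y : Set X) : crossingSet σ Y 1 = Y := by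
  ext x
  have Ico_zero_one : Set.Ico (0 : ℤ) 1 = {0} := by ext; simp; omega
  simp [crossingSet, Ico_zero_one]

theorem crossingSet_mono (σ : X ≃ₜ X) (Y : Set X) :
    MonotoneOn (crossingSet σ Y) (Set.Ici 0) := by
  rintro n (hn : 0 ≤ n) m - hnm x ⟨k, ⟨hk, hk'⟩, hx⟩
  exact ⟨k, ⟨by omega, by omega⟩, hx⟩

theorem mem_crossingSet_or_of_add (hx : x ∈ crossingSet σ Y (n + m)) :
    (σ ^ m) x ∈ crossingSet σ Y n ∨ x ∈ crossingSet σ Y m := by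
  obtain ⟨k, ⟨hk, hk'⟩, hY⟩ := hx
  by_cases hkm : k ∈ Set.Ico (min 0 m) (max 0 m)
  · exact Or.inr ⟨k, hkm, hY⟩
  · simp only [Set.mem_Ico] at hkm
    refine Or.inl ⟨k - m, ⟨by omega, by omega⟩, ?_⟩
    rwa [← zpow_add_apply, sub_add_cancel]

theorem zpow_neg_mem_crossingSet (hx : x ∈ crossingSet σ Y (-n)) :
    (σ ^ (-n)) x ∈ crossingSet σ Y n := by
  obtain ⟨k, ⟨hk, hk'⟩, hY⟩ := hx
  refine ⟨k + n, ⟨by omega, by omega⟩, ?_⟩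
  rwa [← zpow_add_apply, add_neg_cancel_right]

end Shift

/-- A covariant pair for `(X, σ)` in a C*-algebra: a copy of `C(X)` and a unitary implementing
`f ↦ f ∘ σ⁻¹` on it. -/
structure CovariantPair {X : Type*} [TopologicalSpace X] (σ : X ≃ₜ X) (A : Type*)
    [CStarAlgebra A] where
  π : C(X, ℂ) →⋆ₐ[ℂ] A
  U : unitary A
  covariant : ∀ f, (U : A) * π f = π (transl σ f) * U

namespace CovariantPair

variable {X : Type*} [TopologicalSpace X] {σ : X ≃ₜ X} {A : Type*} [CStarAlgebra A]
  (P : CovariantPair σ A)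

theorem semiconjBy_zpow (n : ℤ) (a : C(X, ℂ)) :
    SemiconjBy ((P.U ^ n : unitary A) : A) (P.π (shift σ n a)) (P.π a) := by
  have one_step (a : C(X, ℂ)) : SemiconjBy (P.U : A) (P.π (shift σ 1 a)) (P.π a) := by
    have transl_shift : transl σ (shift σ 1 a) = a :=
      ContinuousMap.ext fun x => congrArg a (σ.apply_symm_apply x)
    rw [SemiconjBy, P.covariant, transl_shift]
  have one_step_inv (a : C(X, ℂ)) :
      SemiconjBy ((P.U⁻¹ : unitary A) : A) (P.π (shift σ (-1) a)) (P.π a) := by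
    have step_shift := one_step (shift σ (-1) a)
    rw [shift_shift, neg_add_cancel, shift_zero] at step_shift
    exact SemiconjBy.units_inv_symm_left (a := Unitary.toUnits P.U) step_shift
  induction n using Int.induction_on with
  | zero => simp
  | succ n ih =>
    rw [zpow_add_one, Submonoid.coe_mul, ← shift_shift]
    exact ih.mul_left (one_step _)
  | pred n ih =>
    rw [zpow_sub_one, Submonoid.coe_mul, sub_eq_add_neg, ← shift_shift]
    exact ih.mul_left (one_step_inv _)

/-- The element `s` equals `Uⁿ π(a)`, where `a` vanishes at the points whose orbit segment to
`σⁿ x` crosses `Y`. For `Y` closed these are the elements of degree `n` of `A_Y`. -/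
structure IsHomog (Y : Set X) (n : ℤ) (a : C(X, ℂ)) (s : A) : Prop where
  eq_mul : s = ((P.U ^ n : unitary A) : A) * P.π a
  apply_eq_zero : ∀ x ∈ crossingSet σ Y n, a x = 0

variable {P} {Y : Set X} {n m : ℤ} {a b : C(X, ℂ)} {s t : A}

theorem isHomog_zero (P : CovariantPair σ A) (Y : Set X) (a : C(X, ℂ)) :
    P.IsHomog Y 0 a (P.π a) :=
  ⟨by simp, by simp⟩

theorem isHomog_one (P : CovariantPair σ A) (Y : Set X) : P.IsHomog Y 0 1 1 := by
  simpa only [map_one] using P.isHomog_zero Y 1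

namespace IsHomog

theorem mul (hs : P.IsHomog Y n a s) (ht : P.IsHomog Y m b t) :
    P.IsHomog Y (n + m) (shift σ m a * b) (s * t) where
  eq_mul := by
    rw [hs.eq_mul, ht.eq_mul, mul_assoc, ← mul_assoc (P.π a), ← (P.semiconjBy_zpow m a).eq,
      zpow_add, Submonoid.coe_mul, map_mul]
    simp only [mul_assoc]
  apply_eq_zero x hx := mul_eq_zero.mpr <|
    (mem_crossingSet_or_of_add hx).imp (hs.apply_eq_zero _) (ht.apply_eq_zero x)

theorem star (hs : P.IsHomog Y n a s) : P.IsHomog Y (-n) (shift σ (-n) (star a)) (star s) where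
  eq_mul := by
    rw [hs.eq_mul, star_mul, ← map_star, ← Unitary.coe_star, Unitary.star_eq_inv, ← zpow_neg,
      (P.semiconjBy_zpow (-n) _).eq]
  apply_eq_zero x hx := by
    rw [shift_apply, ContinuousMap.star_apply, hs.apply_eq_zero _ (zpow_neg_mem_crossingSet hx),
      star_zero]

theorem sub_smul (hs : P.IsHomog Y n a s) (ht : P.IsHomog Y n b t) (z : ℂ) :
    P.IsHomog Y n (a - z • b) (s - z • t) where
  eq_mul := by rw [hs.eq_mul, ht.eq_mul, map_sub, map_smul, mul_sub, mul_smul_comm]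
  apply_eq_zero x hx := by
    rw [ContinuousMap.sub_apply, ContinuousMap.smul_apply, hs.apply_eq_zero x hx,
      ht.apply_eq_zero x hx, smul_zero, sub_zero]

theorem pow (hs : P.IsHomog Y 1 a s) (k : ℕ) :
    P.IsHomog Y k (∏ j ∈ Finset.range k, shift σ j a) (s ^ k) := by
  induction k with
  | zero => simpa only [Nat.cast_zero, Finset.prod_range_zero, pow_zero] using P.isHomog_one Y
  | succ k ih =>
    rw [pow_succ', Finset.prod_range_succ_comm, Nat.cast_succ, add_comm]
    exact hs.mul ih

end IsHomog

/-- The homogeneous elements of `S` span a dense subspace of `S`. -/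
def HomogDense (P : CovariantPair σ A) (Y : Set X) (S : StarSubalgebra ℂ A) : Prop :=
  Dense (Submodule.span ℂ {s : S | ∃ n a, P.IsHomog Y n a s} : Set S)

theorem exists_isHomog_of_mem_closure {G : Set A} (hG : ∀ s ∈ G, ∃ n a, P.IsHomog Y n a s)
    (hs : s ∈ Submonoid.closure (G ∪ star G)) : ∃ n a, P.IsHomog Y n a s := by
  induction hs using Submonoid.closure_induction with
  | mem s hs =>
    rcases hs with hs | hs
    · exact hG s hs
    · obtain ⟨n, a, h⟩ := hG _ hs
      exact ⟨_, _, star_star s ▸ h.star⟩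
  | one => exact ⟨0, 1, P.isHomog_one Y⟩
  | mul s t _ _ hs ht =>
    obtain ⟨n, a, hs⟩ := hs
    obtain ⟨m, b, ht⟩ := ht
    exact ⟨_, _, hs.mul ht⟩

theorem homogDense_topologicalClosure_adjoin {G : Set A}
    (hG : ∀ s ∈ G, ∃ n a, P.IsHomog Y n a s) :
    P.HomogDense Y (StarAlgebra.adjoin ℂ G).topologicalClosure := by
  set S := (StarAlgebra.adjoin ℂ G).topologicalClosure
  set D := Submodule.span ℂ {s : S | ∃ n a, P.IsHomog Y n a s}
  have adjoin_le : (StarAlgebra.adjoin ℂ G).toSubalgebra.toSubmodule ≤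
      D.map S.subtype.toAlgHom.toLinearMap := by
    rw [StarAlgebra.adjoin_eq_span, Submodule.span_le]
    intro s hs
    have mem_adjoin : s ∈ (StarAlgebra.adjoin ℂ G).toSubalgebra.toSubmodule :=
      StarAlgebra.adjoin_eq_span (R := ℂ) G ▸ Submodule.subset_span hs
    exact ⟨⟨s, StarSubalgebra.le_topologicalClosure _ mem_adjoin⟩,
      Submodule.subset_span (exists_isHomog_of_mem_closure hG hs), rfl⟩
  exact Topology.IsInducing.subtypeVal.dense_iff.mpr fun s => closure_mono adjoin_le s.2

end CovariantPair

/-! ### Bottom vectors -/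

theorem comp_mem_of_mem {X : Type*} [TopologicalSpace X] [CompactSpace X]
    {C : StarSubalgebra ℂ C(X, ℂ)} [IsClosed (C : Set C(X, ℂ))] {c : C(X, ℂ)} (hc : c ∈ C)
    (F : C(ℂ, ℂ)) : F.comp c ∈ C := by
  suffices cfc F c = F.comp c from this ▸ cfc_mem F hc
  ext x
  calc cfc F c x = cfc F (algebraMap ℂ ℂ (c x)) :=
        StarAlgHom.map_cfc (ContinuousMap.evalStarAlgHom ℂ ℂ x) F c F.continuous.continuousOn
          (continuous_eval_const x)
    _ = F.comp c x := cfc_algebraMap _ _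

theorem exists_continuousMap_eq_zero_of_norm_lt {δ : ℝ} (hδ : 0 < δ) :
    ∃ F : C(ℂ, ℂ), (∀ z, ‖z‖ < δ → F z = 0) ∧ ∀ z, ‖z - F z‖ ≤ δ := by
  have max_pos (z : ℂ) : 0 < max δ ‖z‖ := lt_max_of_lt_left hδ
  have continuous_retraction : Continuous fun z : ℂ => (δ / max δ ‖z‖) • z :=
    (continuous_const.div (by fun_prop) fun z => (max_pos z).ne').smul continuous_id
  refine ⟨⟨fun z => z - (δ / max δ ‖z‖) • z, by fun_prop⟩, fun z hz => ?_, fun z => ?_⟩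
  · simp [max_eq_left hz.le, hδ.ne']
  · rw [ContinuousMap.coe_mk, sub_sub_cancel, norm_smul, Real.norm_eq_abs,
      abs_of_pos (div_pos hδ (max_pos z)), div_mul_eq_mul_div, div_le_iff₀ (max_pos z)]
    gcongr
    exact le_max_right _ _

namespace CovariantPair.IsHomog

variable {X : Type*} [TopologicalSpace X] {σ : X ≃ₜ X} {A : Type*} [CStarAlgebra A]
  {P : CovariantPair σ A} {Y : Set X} {n : ℤ} {a : C(X, ℂ)} {s : A}

theorem eq_apply (hs : P.IsHomog Y 0 a s) : s = P.π a := by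
  simpa using hs.eq_mul

theorem eq_zero (hn : crossingSet σ Y n = Set.univ) (hs : P.IsHomog Y n a s) : s = 0 := by
  have a_eq_zero : a = 0 := ContinuousMap.ext fun x => hs.apply_eq_zero x (hn ▸ Set.mem_univ x)
  rw [hs.eq_mul, a_eq_zero, map_zero, mul_zero]

theorem exists_comp [CompactSpace X] {S : StarSubalgebra ℂ A} [hS : IsClosed (S : Set A)] {s : S}
    (hs : P.IsHomog Y 0 a s) (F : C(ℂ, ℂ)) : ∃ t : S, P.IsHomog Y 0 (F.comp a) t := by
  have : IsClosed (S.comap P.π : Set C(X, ℂ)) := hS.preimage (map_continuous P.π)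
  have a_mem : P.π a ∈ S := hs.eq_apply ▸ s.2
  exact ⟨⟨P.π (F.comp a), comp_mem_of_mem (C := S.comap P.π) a_mem F⟩, P.isHomog_zero Y _⟩

end CovariantPair.IsHomog

namespace IrrRep

section Basic

variable {A : Type u} [CStarAlgebra A] {S : StarSubalgebra ℂ A} (ρ : IrrRep S)

theorem mul_apply (s t : S) (v : ρ.H) : ρ.π (s * t) v = ρ.π s (ρ.π t v) := by
  rw [map_mul]; rfl

theorem inner_apply_left (s : S) (v w : ρ.H) : ⟪ρ.π s v, w⟫_ℂ = ⟪v, ρ.π (star s) w⟫_ℂ := by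
  rw [map_star, ContinuousLinearMap.star_eq_adjoint, ContinuousLinearMap.adjoint_inner_right]

theorem π_one : ρ.π 1 = 1 := by
  let fixed : Submodule ℂ ρ.H := (ρ.π 1 : ρ.H →ₗ[ℂ] ρ.H).eqLocus LinearMap.id
  have apply_mem_fixed (s : S) (v : ρ.H) : ρ.π s v ∈ fixed := by
    change ρ.π 1 (ρ.π s v) = ρ.π s v
    rw [← ρ.mul_apply, one_mul]
  have fixed_isClosed : IsClosed (fixed : Set ρ.H) :=
    isClosed_eq (ρ.π 1).continuous continuous_id
  rcases ρ.irreducible fixed fixed_isClosed fun s v _ => apply_mem_fixed s v with h | h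
  · exact absurd (by ext s v; simpa [h] using apply_mem_fixed s v) ρ.ne_zero
  · ext v
    exact (h ▸ Submodule.mem_top : v ∈ fixed)

theorem eq_top_of_forall_apply_mem {v : ρ.H} (hv : v ≠ 0) {L : Submodule ℂ ρ.H}
    (hL : IsClosed (L : Set ρ.H)) (h : ∀ s, ρ.π s v ∈ L) : L = ⊤ := by
  let K : Submodule ℂ ρ.H := ⨅ s : S, L.comap (ρ.π s : ρ.H →ₗ[ℂ] ρ.H)
  have mem_K (w : ρ.H) : w ∈ K ↔ ∀ s, ρ.π s w ∈ L := by simp [K]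
  have K_isClosed : IsClosed (K : Set ρ.H) := by
    simp only [K, Submodule.coe_iInf]
    exact isClosed_iInter fun s => hL.preimage (ρ.π s).continuous
  have K_invariant (s : S) (w : ρ.H) (hw : w ∈ K) : ρ.π s w ∈ K :=
    (mem_K _).mpr fun t => ρ.mul_apply t s w ▸ (mem_K w).mp hw (t * s)
  rcases ρ.irreducible K K_isClosed K_invariant with hK | hK
  · exact absurd (by simpa [hK] using (mem_K v).mpr h) hv
  · refine Submodule.eq_top_iff'.mpr fun w => ?_
    simpa [ρ.π_one] using (mem_K w).mp (hK ▸ Submodule.mem_top) 1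

variable [IsClosed (S : Set A)]

/-- The orbit map of a vector. -/
def orbitMap (v : ρ.H) : S →L[ℂ] ρ.H where
  toFun s := ρ.π s v
  map_add' := by simp
  map_smul' := by simp
  cont := (ContinuousLinearMap.apply ℂ ρ.H v).continuous.comp (map_continuous ρ.π)

end Basic

variable {X : Type*} [TopologicalSpace X] {σ : X ≃ₜ X} {A : Type u} [CStarAlgebra A]
  {P : CovariantPair σ A} {Y : Set X} {S : StarSubalgebra ℂ A} {ρ : IrrRep S} {n : ℤ}
  {a b : C(X, ℂ)} {s t : S}

theorem eq_top_of_forall_isHomog_apply_mem [IsClosed (S : Set A)] (hS : P.HomogDense Y S)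
    {v : ρ.H} (hv : v ≠ 0) {L : Submodule ℂ ρ.H} (hL : IsClosed (L : Set ρ.H))
    (h : ∀ n a (s : S), P.IsHomog Y n a s → ρ.π s v ∈ L) : L = ⊤ := by
  have span_le : Submodule.span ℂ {s : S | ∃ n a, P.IsHomog Y n a s} ≤
      L.comap (ρ.orbitMap v : S →ₗ[ℂ] ρ.H) :=
    Submodule.span_le.mpr fun s ⟨n, a, hs⟩ => h n a s hs
  exact ρ.eq_top_of_forall_apply_mem hv hL fun s =>
    closure_minimal span_le (hL.preimage (ρ.orbitMap v).continuous) (hS s)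

/-- The vector `v` is annihilated by the adjoints of the homogeneous elements of positive
degree. -/
def IsBottom (ρ : IrrRep S) (P : CovariantPair σ A) (Y : Set X) (v : ρ.H) : Prop :=
  ∀ n > 0, ∀ (a : C(X, ℂ)) (s : S), P.IsHomog Y n a s → ρ.π (star s) v = 0

namespace IsBottom

variable {v w : ρ.H}

theorem apply_eq_zero (hv : ρ.IsBottom P Y v) (hn : n < 0) (hs : P.IsHomog Y n a s) :
    ρ.π s v = 0 := by
  simpa only [star_star] using hv (-n) (by omega) _ (star s) hs.star

theorem inner_apply_eq_zero (hv : ρ.IsBottom P Y v) (hw : ρ.IsBottom P Y w) (hn : n ≠ 0)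
    (hs : P.IsHomog Y n a s) : ⟪ρ.π s v, w⟫_ℂ = 0 := by
  rcases lt_or_gt_of_ne hn with hn | hn
  · rw [hv.apply_eq_zero hn hs, inner_zero_left]
  · rw [inner_apply_left, hw n hn a s hs, inner_zero_right]

theorem apply (hv : ρ.IsBottom P Y v) (hs : P.IsHomog Y 0 a s) : ρ.IsBottom P Y (ρ.π s v) := by
  intro n hn b t ht
  simpa only [star_mul, star_star, mul_apply] using
    hv (-0 + n) (by omega) _ (star s * t) (hs.star.mul ht)

end IsBottom

theorem exists_isBottom (ρ : IrrRep S) {N : ℤ} (hN₀ : 0 ≤ N)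
    (hN : crossingSet σ Y N = Set.univ) : ∃ v, v ≠ 0 ∧ ρ.IsBottom P Y v := by
  let Acts (n : ℤ) : Prop := ∃ (a : C(X, ℂ)) (s : S), P.IsHomog Y n a s ∧ ρ.π (star s) ≠ 0
  have acts_le (n : ℤ) (hn : Acts n) : n ≤ N := by
    obtain ⟨a, s, hs, hne⟩ := hn
    by_contra! hlt
    have s_eq_zero : s = 0 := Subtype.ext <| hs.eq_zero <| Set.univ_subset_iff.mp <|
      hN ▸ crossingSet_mono σ Y hN₀ (hN₀.trans hlt.le) hlt.le
    exact hne (by rw [s_eq_zero, star_zero, map_zero])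
  have acts_zero : Acts 0 := by
    refine ⟨1, 1, P.isHomog_one Y, fun h => ρ.ne_zero ?_⟩
    ext s v
    rw [← one_mul s, ρ.mul_apply, ← star_one S, h]
    rfl
  obtain ⟨n, ⟨a, s, hs, hne⟩, hmax⟩ := Int.exists_greatest_of_bdd ⟨N, acts_le⟩ ⟨0, acts_zero⟩
  obtain ⟨v, hv⟩ := DFunLike.ne_iff.mp hne
  refine ⟨ρ.π (star s) v, hv, fun m hm b t ht => ?_⟩
  by_contra hst
  rw [← mul_apply, ← star_mul] at hst
  have add_le := hmax (n + m) ⟨_, s * t, hs.mul ht, fun h => hst (by rw [h]; rfl)⟩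
  omega

variable [IsClosed (S : Set A)]

/-- If `s * t` killed all bottom vectors, then `star s * s` would map `v` to a vector orthogonal to
the cyclic subspace generated by `t w`. -/
theorem exists_isBottom_mul_apply_ne_zero (hS : P.HomogDense Y S) (hs : P.IsHomog Y 0 a s)
    (ht : P.IsHomog Y 0 b t) (hsv : ∃ v, ρ.IsBottom P Y v ∧ ρ.π s v ≠ 0)
    (htw : ∃ w, ρ.IsBottom P Y w ∧ ρ.π t w ≠ 0) :
    ∃ w, ρ.IsBottom P Y w ∧ ρ.π (s * t) w ≠ 0 := by
  obtain ⟨v, hv, hsv⟩ := hsv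
  obtain ⟨w, hw, htw⟩ := htw
  by_contra! hzero
  let v' := ρ.π (star s) (ρ.π s v)
  have hv' : ρ.IsBottom P Y v' := (hv.apply hs).apply (neg_zero (G := ℤ) ▸ hs.star)
  have orthogonal_eq_top : (ℂ ∙ v')ᗮ = ⊤ := by
    refine eq_top_of_forall_isHomog_apply_mem hS htw (Submodule.isClosed_orthogonal _)
      fun n c r hr => Submodule.mem_orthogonal_singleton_iff_inner_left.mpr ?_
    by_cases hn : n = 0
    · subst hn
      have hcomm : s * (r * t) = r * (s * t) := by
        ext
        simp only [MulMemClass.coe_mul, hs.eq_apply, ht.eq_apply, hr.eq_apply, ← map_mul]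
        rw [mul_left_comm]
      rw [← inner_apply_left, ← ρ.mul_apply r, ← mul_apply, hcomm, mul_apply, hzero w hw,
        map_zero, inner_zero_left]
    · exact (hw.apply ht).inner_apply_eq_zero hv' hn hr
  have v'_eq_zero : v' = 0 := by simpa using orthogonal_eq_top
  refine hsv (inner_self_eq_zero (𝕜 := ℂ).mp ?_)
  rw [inner_apply_left, show ρ.π (star s) (ρ.π s v) = 0 from v'_eq_zero, inner_zero_right]

theorem finset_prod_ne_zero_of_exists_isBottom (hS : P.HomogDense Y S)
    (hv : ∃ v, v ≠ 0 ∧ ρ.IsBottom P Y v) {κ : Type*} (I : Finset κ) (c : κ → C(X, ℂ)) (s : κ → S)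
    (hs : ∀ k, P.IsHomog Y 0 (c k) (s k)) (hsv : ∀ k, ∃ v, ρ.IsBottom P Y v ∧ ρ.π (s k) v ≠ 0) :
    ∏ k ∈ I, c k ≠ 0 := by
  classical
  obtain ⟨z, hz, v, -, hzv⟩ :
      ∃ z : S, P.IsHomog Y 0 (∏ k ∈ I, c k) z ∧ ∃ v, ρ.IsBottom P Y v ∧ ρ.π z v ≠ 0 := by
    induction I using Finset.induction_on with
    | empty =>
      obtain ⟨v, hv₀, hv⟩ := hv
      exact ⟨1, P.isHomog_one Y, v, hv, by rwa [π_one]⟩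
    | insert k I hk ih =>
      obtain ⟨z, hz, hzv⟩ := ih
      refine ⟨s k * z, ?_, exists_isBottom_mul_apply_ne_zero hS (hs k) hz (hsv k) hzv⟩
      rw [Finset.prod_insert hk]
      simpa only [shift_zero, add_zero, MulMemClass.coe_mul] using (hs k).mul hz
  intro prod_eq_zero
  have z_eq_zero : z = 0 := Subtype.ext (by rw [hz.eq_apply, prod_eq_zero, map_zero]; rfl)
  exact hzv (by rw [z_eq_zero, map_zero]; rfl)

theorem exists_isHomog_eventuallyEq_zero [CompactSpace X] {x : X} {v : ρ.H}
    (hs : P.IsHomog Y 0 a s) (hx : ρ.π s v ≠ a x • v) :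
    ∃ (c : C(X, ℂ)) (t : S), P.IsHomog Y 0 c t ∧ c =ᶠ[𝓝 x] 0 ∧ ρ.π t v ≠ 0 := by
  let a₀ : C(X, ℂ) := a - a x • 1
  let s₀ : S := s - a x • 1
  have hs₀ : P.IsHomog Y 0 a₀ s₀ := hs.sub_smul (P.isHomog_one Y) (a x)
  have apply_ne_zero : ρ.π s₀ v ≠ 0 := by
    simpa [s₀, π_one, sub_eq_zero] using hx
  obtain ⟨δ, hδ, hδv⟩ := exists_pos_mul_lt (norm_pos_iff.mpr apply_ne_zero) ‖v‖
  obtain ⟨F, hF, hF'⟩ := exists_continuousMap_eq_zero_of_norm_lt hδ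
  obtain ⟨t, ht⟩ := hs₀.exists_comp F
  refine ⟨F.comp a₀, t, ht, ?_, fun htv => ?_⟩
  · have norm_a₀_lt : ‖a₀ x‖ < δ := by simpa [a₀] using hδ
    filter_upwards [a₀.continuous.norm.continuousAt.eventually_lt_const norm_a₀_lt] with z hz
    exact hF _ hz
  · have norm_sub_le : ‖s₀ - t‖ ≤ δ := by
      change ‖(s₀ : A) - t‖ ≤ δ
      rw [hs₀.eq_apply, ht.eq_apply, ← map_sub]
      exact (NonUnitalStarAlgHom.norm_apply_le P.π _).trans
        ((ContinuousMap.norm_le _ hδ.le).mpr fun z => hF' _)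
    have norm_apply_le := (ρ.π (s₀ - t)).le_of_opNorm_le
      ((NonUnitalStarAlgHom.norm_apply_le ρ.π _).trans norm_sub_le) v
    rw [map_sub, sub_apply, htv, sub_zero] at norm_apply_le
    linarith

/-- The degree zero part of `S` is a commutative algebra acting without zero divisors on the bottom
vectors, so it acts there by a character. -/
theorem exists_forall_isBottom_apply_eq_smul [CompactSpace X] (hS : P.HomogDense Y S)
    (hv : ∃ v, v ≠ 0 ∧ ρ.IsBottom P Y v) :
    ∃ x : X, ∀ v, ρ.IsBottom P Y v → ∀ a (s : S), P.IsHomog Y 0 a s → ρ.π s v = a x • v := by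
  by_contra! h
  have vanishing_near (x : X) : ∃ (c : C(X, ℂ)) (t : S), P.IsHomog Y 0 c t ∧ c =ᶠ[𝓝 x] 0 ∧
      ∃ v, ρ.IsBottom P Y v ∧ ρ.π t v ≠ 0 := by
    obtain ⟨v, hv, a, s, hs, hne⟩ := h x
    obtain ⟨c, t, ht, hc, htv⟩ := exists_isHomog_eventuallyEq_zero hs hne
    exact ⟨c, t, ht, hc, v, hv, htv⟩
  choose c t ht hc htv using vanishing_near
  obtain ⟨I, -, hI⟩ := isCompact_univ.elim_nhds_subcover (fun x => {z | c x z = 0}) fun x _ => hc x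
  refine finset_prod_ne_zero_of_exists_isBottom hS hv I c t ht htv ?_
  ext z
  obtain ⟨x, hx, hxz⟩ := Set.mem_iUnion₂.mp (hI (Set.mem_univ z))
  rw [ContinuousMap.prod_apply]
  exact Finset.prod_eq_zero hx hxz

end IrrRep

/-! ### Orbit bases -/

namespace IrrRep

variable {X : Type*} [TopologicalSpace X] {σ : X ≃ₜ X} {A : Type u} [CStarAlgebra A]
  {P : CovariantPair σ A} {Y : Set X} {S : StarSubalgebra ℂ A} {ρ : IrrRep S}

/-- The unit vector `v` is a bottom vector on which the elements of degree zero act by evaluation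
at `x`. -/
structure IsLowestWeight (ρ : IrrRep S) (P : CovariantPair σ A) (Y : Set X) (x : X) (v : ρ.H) :
    Prop where
  norm_eq_one : ‖v‖ = 1
  isBottom : ρ.IsBottom P Y v
  apply_eq_smul : ∀ {a : C(X, ℂ)} {s : S}, P.IsHomog Y 0 a s → ρ.π s v = a x • v

theorem exists_isLowestWeight [CompactSpace X] [IsClosed (S : Set A)] (ρ : IrrRep S)
    (hS : P.HomogDense Y S) {N : ℤ} (hN₀ : 0 ≤ N) (hN : crossingSet σ Y N = Set.univ) :
    ∃ x v, ρ.IsLowestWeight P Y x v := by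
  have exists_isBottom := ρ.exists_isBottom (P := P) hN₀ hN
  obtain ⟨x, hx⟩ := exists_forall_isBottom_apply_eq_smul hS exists_isBottom
  obtain ⟨v, hv₀, hv⟩ := exists_isBottom
  have isBottom_smul : ρ.IsBottom P Y ((‖v‖ : ℂ)⁻¹ • v) := fun n hn a s hs => by
    rw [map_smul, hv n hn a s hs, smul_zero]
  exact ⟨x, (‖v‖ : ℂ)⁻¹ • v, by simp [norm_smul, hv₀], isBottom_smul, hx _ isBottom_smul _ _⟩

namespace IsLowestWeight

variable {x : X} {v : ρ.H} {n m : ℤ} {a b : C(X, ℂ)} {s t : S}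

theorem inner_apply_apply (hv : ρ.IsLowestWeight P Y x v) (hs : P.IsHomog Y n a s)
    (ht : P.IsHomog Y m b t) :
    ⟪ρ.π s v, ρ.π t v⟫_ℂ = if n = m then star (a x) * b x else 0 := by
  have hst : P.IsHomog Y (-n + m) _ (star s * t : S) := hs.star.mul ht
  rw [← star_star s, inner_apply_left, star_star, ← mul_apply]
  split_ifs with hnm
  · subst hnm
    rw [neg_add_cancel] at hst
    rw [hv.apply_eq_smul hst, inner_smul_right, inner_self_eq_norm_sq_to_K, hv.norm_eq_one,
      ContinuousMap.mul_apply, shift_shift, neg_add_cancel, shift_zero]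
    simp
  · rw [← inner_conj_symm, hv.isBottom.inner_apply_eq_zero hv.isBottom (by omega) hst, map_zero]

theorem apply_eq_zero (hv : ρ.IsLowestWeight P Y x v) (hs : P.IsHomog Y n a s) (ha : a x = 0) :
    ρ.π s v = 0 := by
  rw [← inner_self_eq_zero (𝕜 := ℂ), hv.inner_apply_apply hs hs, ha, mul_zero, ite_self]

theorem apply_eq_div_smul (hv : ρ.IsLowestWeight P Y x v) (hs : P.IsHomog Y n a s)
    (ht : P.IsHomog Y n b t) (hb : b x ≠ 0) : ρ.π s v = (a x / b x) • ρ.π t v := by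
  have sub_apply_eq_zero :=
    hv.apply_eq_zero (s := s - (a x / b x) • t) (hs.sub_smul ht _) (by simp [hb])
  rwa [map_sub, sub_apply, sub_eq_zero, map_smul, smul_apply] at sub_apply_eq_zero

theorem exists_orthonormalBasis [IsClosed (S : Set A)] (hS : P.HomogDense Y S)
    (hv : ρ.IsLowestWeight P Y x v) {δ : ℕ} (hδ : (σ ^ (δ : ℤ)) x ∈ Y)
    {c : Fin (δ + 1) → C(X, ℂ)} {t : Fin (δ + 1) → S}
    (ht : ∀ k : Fin (δ + 1), P.IsHomog Y (k : ℕ) (c k) (t k)) (hc : ∀ k, c k x ≠ 0) :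
    ∃ b : OrthonormalBasis (Fin (δ + 1)) ℂ ρ.H, ∀ k, b k = (c k x)⁻¹ • ρ.π (t k) v := by
  let e (k : Fin (δ + 1)) : ρ.H := (c k x)⁻¹ • ρ.π (t k) v
  have e_orthonormal : Orthonormal ℂ e := by
    rw [orthonormal_iff_ite]
    intro k l
    rw [inner_smul_left, inner_smul_right, hv.inner_apply_apply (ht k) (ht l)]
    by_cases hkl : k = l
    · subst hkl
      have hk := hc k
      have hk' := star_ne_zero.mpr hk
      rw [if_pos rfl, if_pos rfl, starRingEnd_apply, star_inv₀]
      field_simp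
    · simp [hkl, Fin.val_inj]
  have apply_mem_span (n : ℤ) (a : C(X, ℂ)) (s : S) (hs : P.IsHomog Y n a s) :
      ρ.π s v ∈ Submodule.span ℂ (Set.range e) := by
    rcases lt_or_ge n 0 with hneg | hpos
    · exact hv.isBottom.apply_eq_zero hneg hs ▸ Submodule.zero_mem _
    lift n to ℕ using hpos
    rcases lt_or_ge δ n with hlt | hle
    · have a_eq_zero := hs.apply_eq_zero x ⟨δ, ⟨by omega, by omega⟩, hδ⟩
      exact hv.apply_eq_zero hs a_eq_zero ▸ Submodule.zero_mem _
    · let k : Fin (δ + 1) := ⟨n, by omega⟩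
      rw [hv.apply_eq_div_smul hs (ht k) (hc k), div_eq_mul_inv, mul_smul]
      exact Submodule.smul_mem _ _ (Submodule.subset_span ⟨k, rfl⟩)
  have span_eq_top : Submodule.span ℂ (Set.range e) = ⊤ := by
    have := FiniteDimensional.span_of_finite ℂ (Set.finite_range e)
    refine eq_top_of_forall_isHomog_apply_mem hS (v := v) ?_
      (Submodule.closed_of_finiteDimensional _) apply_mem_span
    exact norm_ne_zero_iff.mp (by simp [hv.norm_eq_one])
  exact ⟨OrthonormalBasis.mk e_orthonormal span_eq_top.ge, fun k => by simp [e]⟩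

end IsLowestWeight

/-- In the orthonormal basis `b`, the representation `ρ` is the one attached to the orbit segment
`x, σ x, …, σ^δ x` between two consecutive visits to `Y`: the homogeneous elements of degree `n` act
by weighted shifts `b k ↦ b (k + n)`. -/
structure IsOrbitBasis (P : CovariantPair σ A) (Y : Set X) (ρ : IrrRep S) (x : X) {δ : ℕ}
    (b : OrthonormalBasis (Fin (δ + 1)) ℂ ρ.H) : Prop where
  pred_mem : (σ ^ (-1 : ℤ)) x ∈ Y
  last_mem : (σ ^ (δ : ℤ)) x ∈ Y
  notMem : ∀ k < δ, (σ ^ (k : ℤ)) x ∉ Y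
  inner_apply : ∀ {n : ℤ} {a : C(X, ℂ)} {s : S}, P.IsHomog Y n a s → ∀ k l : Fin (δ + 1),
    ⟪b l, ρ.π s (b k)⟫_ℂ = if (l : ℕ) = n + (k : ℕ) then a ((σ ^ ((k : ℕ) : ℤ)) x) else 0

theorem prod_shift_apply_ne_zero {h : C(X, ℂ)} (hY : ∀ x ∉ Y, h x ≠ 0) {x : X} {k : ℕ}
    (hx : ∀ j < k, (σ ^ (j : ℤ)) x ∉ Y) : (∏ j ∈ Finset.range k, shift σ j h) x ≠ 0 := by
  rw [ContinuousMap.prod_apply, Finset.prod_ne_zero_iff]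
  exact fun j hj => hY _ (hx j (Finset.mem_range.mp hj))

theorem IsLowestWeight.zpow_neg_one_mem {x : X} {v : ρ.H} (hv : ρ.IsLowestWeight P Y x v)
    {h : C(X, ℂ)} (hY : ∀ x ∉ Y, h x ≠ 0) {T : S} (hT : P.IsHomog Y 1 h T) :
    (σ ^ (-1 : ℤ)) x ∈ Y := by
  by_contra hx
  have hstar : P.IsHomog Y (-1) _ (star T : S) := hT.star
  have inner_eq := hv.inner_apply_apply hstar hstar
  rw [hv.isBottom 1 one_pos h T hT, inner_zero_left, if_pos rfl] at inner_eq
  simp [-zpow_neg, hY _ hx] at inner_eq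

theorem exists_isOrbitBasis [CompactSpace X] [IsClosed (S : Set A)] (ρ : IrrRep S)
    (hS : P.HomogDense Y S) {h : C(X, ℂ)} (hY : ∀ x ∉ Y, h x ≠ 0) {T : S}
    (hT : P.IsHomog Y 1 h T) {N : ℕ} (hN : crossingSet σ Y N = Set.univ) :
    ∃ (x : X) (δ : ℕ) (b : OrthonormalBasis (Fin (δ + 1)) ℂ ρ.H), IsOrbitBasis P Y ρ x b := by
  classical
  obtain ⟨x, v, hv⟩ := ρ.exists_isLowestWeight hS (Nat.cast_nonneg N) hN
  have exists_mem : ∃ k : ℕ, (σ ^ (k : ℤ)) x ∈ Y := by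
    obtain ⟨k, ⟨hk, -⟩, hx⟩ : x ∈ crossingSet σ Y N := hN ▸ Set.mem_univ x
    lift k to ℕ using by omega
    exact ⟨k, hx⟩
  obtain ⟨δ, hδ, hδ_min⟩ := Nat.findX exists_mem
  let c (k : ℕ) : C(X, ℂ) := ∏ j ∈ Finset.range k, shift σ j h
  have c_ne_zero (k : ℕ) (hk : k ≤ δ) : c k x ≠ 0 :=
    prod_shift_apply_ne_zero hY fun j hj => hδ_min j (hj.trans_le hk)
  obtain ⟨b, hb⟩ := hv.exists_orthonormalBasis hS hδ (c := fun k => c k) (t := fun k => T ^ (k : ℕ))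
    (fun k => hT.pow (k : ℕ)) fun k => c_ne_zero k (Nat.lt_succ_iff.mp k.2)
  refine ⟨x, δ, b, hv.zpow_neg_one_mem hY hT, hδ, hδ_min, fun {n a s} hs k l => ?_⟩
  have hk := c_ne_zero k (by omega)
  have hl := c_ne_zero l (by omega)
  have hsT : P.IsHomog Y (n + (k : ℕ)) (shift σ (k : ℕ) a * c k) (s * T ^ (k : ℕ) : S) :=
    hs.mul (hT.pow k)
  have hTl : P.IsHomog Y (l : ℕ) (c l) (T ^ (l : ℕ) : S) := hT.pow l
  rw [hb k, hb l, map_smul, ← mul_apply, inner_smul_left, inner_smul_right,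
    hv.inner_apply_apply hTl hsT]
  split_ifs
  · have hl' := star_ne_zero.mpr hl
    rw [ContinuousMap.mul_apply, shift_apply, starRingEnd_apply, star_inv₀]
    field_simp
  · simp

end IrrRep

/-! ### The topology of the primitive ideal space -/

theorem ne_zero_iff_exists_inner_ne_zero {ι H : Type*} [Fintype ι] [NormedAddCommGroup H]
    [InnerProductSpace ℂ H] (b : OrthonormalBasis ι ℂ H) {f : H →L[ℂ] H} :
    f ≠ 0 ↔ ∃ k l, ⟪b l, f (b k)⟫_ℂ ≠ 0 := by
  rw [← not_iff_not]
  push Not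
  refine ⟨fun hf k l => by simp [hf], fun h => ?_⟩
  refine ContinuousLinearMap.coe_injective (b.toBasis.ext fun k => ?_)
  rw [b.coe_toBasis, ContinuousLinearMap.coe_coe, ← b.sum_repr' (f (b k))]
  simp [h]

theorem eq_top_of_le_topologicalClosure_adjoin {A : Type*} [CStarAlgebra A] {G : Set A}
    {S : StarSubalgebra ℂ A} [IsClosed (S : Set A)]
    (hS : S ≤ (StarAlgebra.adjoin ℂ G).topologicalClosure) {D : StarSubalgebra ℂ S}
    (hD : IsClosed (D : Set S)) (hG : G ⊆ D.map S.subtype) : D = ⊤ := by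
  have map_isClosed : IsClosed (D.map S.subtype : Set A) := by
    rw [StarSubalgebra.coe_map]
    exact (IsClosed.isClosedEmbedding_subtypeVal ‹_›).isClosedMap _ hD
  have S_le_map : S ≤ D.map S.subtype :=
    hS.trans (StarSubalgebra.topologicalClosure_minimal (StarAlgebra.adjoin_le hG) map_isClosed)
  refine eq_top_iff.mpr fun s _ => ?_
  obtain ⟨t, ht, hts⟩ := S_le_map s.2
  exact Subtype.ext hts ▸ ht

namespace IrrRep

variable {X : Type*} [TopologicalSpace X] {σ : X ≃ₜ X} {A : Type u} [CStarAlgebra A]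
  {P : CovariantPair σ A} {Y : Set X} {δ : ℕ}

theorem mem_ker_iff {S : StarSubalgebra ℂ A} (ρ : IrrRep S) (s : S) : s ∈ ρ.ker ↔ ρ.π s = 0 :=
  TwoSidedIdeal.mem_ker _

section OrbitBasis

variable {S : StarSubalgebra ℂ A} {ρ : IrrRep S} {x : X}
  {b : OrthonormalBasis (Fin (δ + 1)) ℂ ρ.H} {c h : C(X, ℂ)} {s T : S}

namespace IsOrbitBasis

/-- `Tᵏ(T*)^δ` sends `b δ` to a nonzero multiple of `b k` and kills the other basis vectors. -/
theorem apply_mul_ne_zero_iff (hb : IsOrbitBasis P Y ρ x b) (hY : ∀ x ∉ Y, h x ≠ 0)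
    (hT : P.IsHomog Y 1 h T) (hs : P.IsHomog Y 0 c s) (k : Fin (δ + 1)) :
    ρ.π (s * (T ^ (k : ℕ) * star (T ^ δ))) ≠ 0 ↔ c ((σ ^ ((k : ℕ) : ℤ)) x) ≠ 0 := by
  let w (k : ℕ) : C(X, ℂ) := ∏ j ∈ Finset.range k, shift σ j h
  have w_ne_zero (k : ℕ) (hk : k ≤ δ) : w k x ≠ 0 :=
    prod_shift_apply_ne_zero hY fun j hj => hb.notMem j (hj.trans_le hk)
  have hstar : P.IsHomog Y (-δ) (shift σ (-δ) (star (w δ))) (star (T ^ δ) : S) := (hT.pow δ).star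
  have hprod : P.IsHomog Y (0 + (k + -δ)) (shift σ (k + -δ) c *
      (shift σ (-δ) (w k) * shift σ (-δ) (star (w δ)))) (s * (T ^ (k : ℕ) * star (T ^ δ)) : S) :=
    hs.mul ((hT.pow k).mul hstar)
  have zpow_sub_apply : (σ ^ ((k : ℕ) + -δ : ℤ)) ((σ ^ (δ : ℤ)) x) = (σ ^ ((k : ℕ) : ℤ)) x := by
    rw [← zpow_add_apply, neg_add_cancel_right]
  have zpow_neg_apply : (σ ^ (-δ : ℤ)) ((σ ^ (δ : ℤ)) x) = x := by
    rw [← zpow_add_apply, neg_add_cancel, zpow_zero]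
    rfl
  simp only [ne_zero_iff_exists_inner_ne_zero b, hb.inner_apply hprod, ite_ne_right_iff,
    ContinuousMap.mul_apply]
  constructor
  · rintro ⟨j, i, -, hj⟩
    obtain hlt | hj_eq := (Nat.lt_succ_iff.mp j.2).lt_or_eq
    · have star_apply_eq_zero := hstar.apply_eq_zero ((σ ^ ((j : ℕ) : ℤ)) x)
        ⟨-1 - (j : ℕ), by simp; omega, by rw [← zpow_add_apply, sub_add_cancel]; exact hb.pred_mem⟩
      rw [star_apply_eq_zero, mul_zero, mul_zero] at hj
      exact absurd rfl hj
    · rw [hj_eq, shift_apply, zpow_sub_apply] at hj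
      exact left_ne_zero_of_mul hj
  · intro hc
    refine ⟨Fin.last δ, k, by simp, ?_⟩
    rw [Fin.val_last, shift_apply, shift_apply, shift_apply, zpow_sub_apply, zpow_neg_apply]
    exact mul_ne_zero hc
      (mul_ne_zero (w_ne_zero k (by omega)) (star_ne_zero.mpr (w_ne_zero δ le_rfl)))

end IsOrbitBasis

end OrbitBasis

section Continuity

variable {Z : Type*} [TopologicalSpace Z] {x : Z → X}

theorem continuous_coordinate [CompactSpace X] {S : StarSubalgebra ℂ A} [IsClosed (S : Set A)]
    {ρ : Z → IrrRep S} {b : ∀ z, OrthonormalBasis (Fin (δ + 1)) ℂ (ρ z).H}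
    (hb : ∀ z, IsOrbitBasis P Y (ρ z) (x z) (b z)) (ho : ∀ s, IsOpen {z | (ρ z).π s ≠ 0})
    {c h : C(X, ℂ)} {s T : S} (hY : ∀ x ∉ Y, h x ≠ 0) (hT : P.IsHomog Y 1 h T)
    (hs : P.IsHomog Y 0 c s) (k : Fin (δ + 1)) :
    Continuous fun z => c ((σ ^ ((k : ℕ) : ℤ)) (x z)) := by
  have isOpen_ne_zero (F : C(ℂ, ℂ)) : IsOpen {z | F (c ((σ ^ ((k : ℕ) : ℤ)) (x z))) ≠ 0} := by
    obtain ⟨t, ht⟩ := hs.exists_comp F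
    simpa only [(hb _).apply_mul_ne_zero_iff hY hT ht, ContinuousMap.comp_apply] using
      ho (t * (T ^ (k : ℕ) * star (T ^ δ)))
  refine Metric.continuous_iff'.mpr fun z₀ ε hε => ?_
  let F : C(ℂ, ℂ) :=
    ⟨fun w => (max (ε - dist w (c ((σ ^ ((k : ℕ) : ℤ)) (x z₀)))) 0 : ℝ), by fun_prop⟩
  have F_ne_zero_iff (w : ℂ) : F w ≠ 0 ↔ dist w (c ((σ ^ ((k : ℕ) : ℤ)) (x z₀))) < ε := by
    simp [F]
  filter_upwards [(isOpen_ne_zero F).mem_nhds ((F_ne_zero_iff _).mpr (by simpa using hε))] with z hz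
  exact (F_ne_zero_iff _).mp hz

theorem isClosed_setOf_forall_continuous_inner {S : StarSubalgebra ℂ A} [IsClosed (S : Set A)]
    {ρ : Z → IrrRep S} (b : ∀ z, OrthonormalBasis (Fin (δ + 1)) ℂ (ρ z).H) :
    IsClosed {s : S | ∀ k l, Continuous fun z => ⟪b z l, (ρ z).π s (b z k)⟫_ℂ} := by
  refine isClosed_of_closure_subset fun s hs k l => ?_
  refine continuous_of_uniform_approx_of_continuous fun V hV => ?_
  obtain ⟨ε, hε, hεV⟩ := Metric.mem_uniformity_dist.mp hV
  obtain ⟨t, ht, hst⟩ := Metric.mem_closure_iff.mp hs ε hε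
  refine ⟨_, ht k l, fun z => hεV ?_⟩
  have norm_apply_le : ‖(ρ z).π (s - t) (b z k)‖ ≤ ‖s - t‖ := by
    simpa only [(b z).norm_eq_one, mul_one] using
      ((ρ z).π (s - t)).le_of_opNorm_le (NonUnitalStarAlgHom.norm_apply_le (ρ z).π _) (b z k)
  calc dist ⟪b z l, (ρ z).π s (b z k)⟫_ℂ ⟪b z l, (ρ z).π t (b z k)⟫_ℂ
      = ‖⟪b z l, (ρ z).π (s - t) (b z k)⟫_ℂ‖ := by
        rw [dist_eq_norm, ← inner_sub_right, ← sub_apply, ← map_sub]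
    _ ≤ ‖b z l‖ * ‖(ρ z).π (s - t) (b z k)‖ := norm_inner_le_norm _ _
    _ ≤ ‖s - t‖ := by rwa [(b z).norm_eq_one, one_mul]
    _ < ε := by rwa [← dist_eq_norm]

theorem continuous_inner {S : StarSubalgebra ℂ A} [IsClosed (S : Set A)] {G : Set A}
    (hS : S ≤ (StarAlgebra.adjoin ℂ G).topologicalClosure) {ρ : Z → IrrRep S}
    {b : ∀ z, OrthonormalBasis (Fin (δ + 1)) ℂ (ρ z).H}
    (hG : ∀ a ∈ G, ∃ s : S, s = a ∧ ∀ k l, Continuous fun z => ⟪b z l, (ρ z).π s (b z k)⟫_ℂ)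
    (s : S) (k l : Fin (δ + 1)) : Continuous fun z => ⟪b z l, (ρ z).π s (b z k)⟫_ℂ := by
  let D : StarSubalgebra ℂ S :=
    { carrier := {s | ∀ k l, Continuous fun z => ⟪b z l, (ρ z).π s (b z k)⟫_ℂ}
      add_mem' := fun hs ht k l => by
        simp only [map_add, add_apply, inner_add_right]
        exact (hs k l).add (ht k l)
      mul_mem' := fun {s t} hs ht k l => by
        have inner_mul (z : Z) : ⟪b z l, (ρ z).π (s * t) (b z k)⟫_ℂ =
            ∑ j, ⟪b z j, (ρ z).π t (b z k)⟫_ℂ * ⟪b z l, (ρ z).π s (b z j)⟫_ℂ := by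
          conv_lhs => rw [mul_apply, ← (b z).sum_repr' ((ρ z).π t (b z k))]
          simp only [map_sum, inner_sum, map_smul, inner_smul_right]
        simp only [inner_mul]
        exact continuous_finsetSum _ fun j _ => (ht k j).mul (hs j l)
      algebraMap_mem' := fun r k l => by
        simp only [Algebra.algebraMap_eq_smul_one, map_smul, π_one, smul_apply,
          one_apply_eq_self, inner_smul_right, (b _).inner_eq_ite]
        exact continuous_const
      star_mem' := fun hs k l => by
        simp only [← inner_apply_left]
        simp only [← inner_conj_symm ((ρ _).π _ _)]
        exact Complex.continuous_conj.comp (hs l k) }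
  have D_eq_top : D = ⊤ := eq_top_of_le_topologicalClosure_adjoin hS
    (isClosed_setOf_forall_continuous_inner b) fun a ha => by
      obtain ⟨s, rfl, hs⟩ := hG a ha
      exact ⟨s, hs, rfl⟩
  exact (D_eq_top ▸ StarSubalgebra.mem_top : s ∈ D) k l

end Continuity

theorem topology_primOfDim {S : StarSubalgebra ℂ A} {d : ℕ} {ρ : primOfDim S d → IrrRep S}
    (hρ : ∀ z, (ρ z).ker = z.1.1) :
    instTopologicalSpaceSubtype = .generateFrom (Set.range fun s => {z | (ρ z).π s ≠ 0}) := by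
  have notMem_iff (s : S) (z : primOfDim S d) : s ∉ z.1.1 ↔ (ρ z).π s ≠ 0 := by
    rw [← hρ, mem_ker_iff]
  have setOf_ne_zero_eq (s : S) :
      {z | (ρ z).π s ≠ 0} = Subtype.val ⁻¹' {I : Prim S | s ∉ I.1} :=
    Set.ext fun z => (notMem_iff s z).symm
  have setOf_exists_eq_range :
      {O | ∃ s, O = {I : Prim S | s ∉ I.1}} = Set.range fun s => {I : Prim S | s ∉ I.1} :=
    Set.ext fun O => exists_congr fun s => eq_comm
  rw [instTopologicalSpaceSubtype, instTopologicalSpacePrim, induced_generateFrom_eq,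
    setOf_exists_eq_range, ← Set.range_comp]
  simp only [setOf_ne_zero_eq, Function.comp_def]

end IrrRep

namespace CovariantPair

variable {X : Type*} [TopologicalSpace X] {σ : X ≃ₜ X} {A : Type u} [CStarAlgebra A]
  {κ : Type*} (P : CovariantPair σ A) (ψ : κ → C(X, ℂ)) (i₀ : κ)

/-- The C*-algebra generated by the functions `ψ i` and by `u ψ i₀`. -/
def generatedBy : StarSubalgebra ℂ A :=
  (StarAlgebra.adjoin ℂ
    (Set.range (fun i => P.π (ψ i)) ∪ {(P.U : A) * P.π (ψ i₀)})).topologicalClosure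

instance : IsClosed (P.generatedBy ψ i₀ : Set A) :=
  StarSubalgebra.isClosed_topologicalClosure _

theorem map_mem_generatedBy (i : κ) : P.π (ψ i) ∈ P.generatedBy ψ i₀ :=
  StarSubalgebra.le_topologicalClosure _ (StarAlgebra.subset_adjoin ℂ _ (Or.inl ⟨i, rfl⟩))

theorem mul_map_mem_generatedBy : (P.U : A) * P.π (ψ i₀) ∈ P.generatedBy ψ i₀ :=
  StarSubalgebra.le_topologicalClosure _ (StarAlgebra.subset_adjoin ℂ _ (Or.inr rfl))

variable {Y : Set X} {ψ i₀}

theorem isHomog_mul_map (hY : ∀ x ∈ Y, ψ i₀ x = 0) :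
    P.IsHomog Y 1 (ψ i₀) ((P.U : A) * P.π (ψ i₀)) :=
  ⟨by rw [zpow_one], by rwa [crossingSet_one]⟩

theorem homogDense_generatedBy (hY : ∀ x ∈ Y, ψ i₀ x = 0) :
    P.HomogDense Y (P.generatedBy ψ i₀) := by
  refine homogDense_topologicalClosure_adjoin ?_
  rintro _ (⟨i, rfl⟩ | rfl)
  · exact ⟨0, ψ i, P.isHomog_zero Y _⟩
  · exact ⟨1, ψ i₀, P.isHomog_mul_map hY⟩

end CovariantPair

namespace IrrRep

variable {X : Type*} [TopologicalSpace X] {σ : X ≃ₜ X} {A : Type u} [CStarAlgebra A]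
  {P : CovariantPair σ A} {Y : Set X} {κ : Type*} {ψ : κ → C(X, ℂ)} {i₀ : κ} {δ : ℕ}

theorem continuous_inner_of_continuous_coordinate {Z : Type*} [TopologicalSpace Z] {x : Z → X}
    {ρ : Z → IrrRep (P.generatedBy ψ i₀)} {b : ∀ z, OrthonormalBasis (Fin (δ + 1)) ℂ (ρ z).H}
    (hb : ∀ z, IsOrbitBasis P Y (ρ z) (x z) (b z)) (hY : ∀ x ∈ Y, ψ i₀ x = 0)
    (hx : ∀ i (k : Fin (δ + 1)), Continuous fun z => ψ i ((σ ^ ((k : ℕ) : ℤ)) (x z)))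
    (s : P.generatedBy ψ i₀) (k l : Fin (δ + 1)) :
    Continuous fun z => ⟪b z l, (ρ z).π s (b z k)⟫_ℂ := by
  have continuous_of_isHomog {n : ℤ} {i : κ} {s : P.generatedBy ψ i₀} (hs : P.IsHomog Y n (ψ i) s)
      (k l : Fin (δ + 1)) : Continuous fun z => ⟪b z l, (ρ z).π s (b z k)⟫_ℂ := by
    simp only [(hb _).inner_apply hs]
    exact continuous_if_const _ (fun _ => hx i k) fun _ => continuous_const
  refine continuous_inner (S := P.generatedBy ψ i₀) le_rfl ?_ s k l
  rintro _ (⟨i, rfl⟩ | rfl)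
  · exact ⟨⟨_, P.map_mem_generatedBy ψ i₀ i⟩, rfl, continuous_of_isHomog (P.isHomog_zero Y _)⟩
  · exact ⟨⟨_, P.mul_map_mem_generatedBy ψ i₀⟩, rfl, continuous_of_isHomog (P.isHomog_mul_map hY)⟩

theorem isInducing_coordinate [CompactSpace X] {Z : Type*} [topZ : TopologicalSpace Z] {x : Z → X}
    {ρ : Z → IrrRep (P.generatedBy ψ i₀)} {b : ∀ z, OrthonormalBasis (Fin (δ + 1)) ℂ (ρ z).H}
    (hZ : topZ = .generateFrom (Set.range fun s => {z | (ρ z).π s ≠ 0}))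
    (hb : ∀ z, IsOrbitBasis P Y (ρ z) (x z) (b z)) (hY : ∀ x, x ∈ Y ↔ ψ i₀ x = 0) :
    Topology.IsInducing fun z (ik : κ × Fin (δ + 1)) => ψ ik.1 ((σ ^ ((ik.2 : ℕ) : ℤ)) (x z)) := by
  refine ⟨le_antisymm (Continuous.le_induced (continuous_pi fun ik => ?_)) ?_⟩
  · have isOpen_ne_zero (s : P.generatedBy ψ i₀) : IsOpen {z | (ρ z).π s ≠ 0} :=
      hZ ▸ TopologicalSpace.isOpen_generateFrom_of_mem ⟨s, rfl⟩
    exact continuous_coordinate hb isOpen_ne_zero (fun x hx => (hY x).not.mp hx)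
      (T := ⟨_, P.mul_map_mem_generatedBy ψ i₀⟩) (P.isHomog_mul_map fun x hx => (hY x).mp hx)
      (s := ⟨_, P.map_mem_generatedBy ψ i₀ ik.1⟩) (P.isHomog_zero Y _) ik.2
  · conv_rhs => rw [hZ]
    refine le_generateFrom ?_
    rintro _ ⟨s, rfl⟩
    let p (z : Z) (ik : κ × Fin (δ + 1)) : ℂ := ψ ik.1 ((σ ^ ((ik.2 : ℕ) : ℤ)) (x z))
    let _ : TopologicalSpace Z := .induced p inferInstance
    have continuous_p : Continuous p := continuous_induced_dom
    have continuous_inner := continuous_inner_of_continuous_coordinate hb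
      (fun x hx => (hY x).mp hx) (fun i k => continuous_pi_iff.mp continuous_p (i, k)) s
    simp only [ne_zero_iff_exists_inner_ne_zero (b _), Set.ofPred_exists]
    exact isOpen_iUnion fun k => isOpen_iUnion fun l =>
      isOpen_compl_singleton.preimage (continuous_inner k l)

theorem HasDim.unique {S : StarSubalgebra ℂ A} {ρ : IrrRep S} {d d' : ℕ} (hd : ρ.HasDim d)
    (hd' : ρ.HasDim d') : d = d' :=
  hd.2.symm.trans hd'.2

theorem hasDim_of_orthonormalBasis {S : StarSubalgebra ℂ A} {ρ : IrrRep S} {d : ℕ}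
    (b : OrthonormalBasis (Fin d) ℂ ρ.H) : ρ.HasDim d :=
  ⟨b.toBasis.finiteDimensional_of_finite, by simpa using Module.finrank_eq_card_basis b.toBasis⟩

theorem exists_isOrbitBasis_generatedBy [CompactSpace X] (hY : ∀ x, x ∈ Y ↔ ψ i₀ x = 0) {N : ℕ}
    (hN : crossingSet σ Y N = Set.univ) (ρ : IrrRep (P.generatedBy ψ i₀)) :
    ∃ (x : X) (δ : ℕ) (b : OrthonormalBasis (Fin (δ + 1)) ℂ ρ.H), IsOrbitBasis P Y ρ x b :=
  ρ.exists_isOrbitBasis (P.homogDense_generatedBy fun x hx => (hY x).mp hx)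
    (fun x hx => (hY x).not.mp hx) (T := ⟨_, P.mul_map_mem_generatedBy ψ i₀⟩)
    (P.isHomog_mul_map fun x hx => (hY x).mp hx) hN

theorem coveringDimLE_primOfDim_generatedBy [CompactSpace X] [Finite κ]
    (hY : ∀ x, x ∈ Y ↔ ψ i₀ x = 0) {N : ℕ} (hN : crossingSet σ Y N = Set.univ) (d : ℕ) :
    CoveringDimLE (primOfDim (P.generatedBy ψ i₀) d) (2 * (Nat.card κ * d)) := by
  let Z := primOfDim (P.generatedBy ψ i₀) d
  suffices ∃ p : Z → κ × Fin d → ℂ, Topology.IsInducing p by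
    obtain ⟨p, hp⟩ := this
    simpa only [Nat.card_prod, Nat.card_fin] using coveringDimLE_of_isInducing_complex hp
  rcases isEmpty_or_nonempty Z with _ | ⟨⟨_, ρ₀, hρ₀, -⟩⟩
  · exact ⟨isEmptyElim, ⟨Subsingleton.elim _ _⟩⟩
  obtain ⟨-, δ, b₀, -⟩ := exists_isOrbitBasis_generatedBy hY hN ρ₀
  obtain rfl : d = δ + 1 := hρ₀.unique (hasDim_of_orthonormalBasis b₀)
  have exists_orbitBasis (z : Z) : ∃ (ρ : IrrRep (P.generatedBy ψ i₀)) (x : X)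
      (b : OrthonormalBasis (Fin (δ + 1)) ℂ ρ.H), ρ.ker = z.1.1 ∧ IsOrbitBasis P Y ρ x b := by
    obtain ⟨_, ρ, hρ, hz⟩ := z
    obtain ⟨x, δ', b, hb⟩ := exists_isOrbitBasis_generatedBy hY hN ρ
    obtain rfl : δ' = δ := by simpa using (hasDim_of_orthonormalBasis b).unique hρ
    exact ⟨ρ, x, b, hz, hb⟩
  choose ρ x b hz hb using exists_orbitBasis
  exact ⟨_, isInducing_coordinate (topology_primOfDim hz) hb hY⟩

end IrrRep

/-! ### Return times and the dimension ratio -/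

section Dynamics

variable {X : Type*} [TopologicalSpace X] {σ : X ≃ₜ X} {y : X}

theorem zpow_natCast_apply (σ : X ≃ₜ X) (n : ℕ) (x : X) : (σ ^ (n : ℤ)) x = σ^[n] x := by
  rw [zpow_natCast, ← hom_coe_pow (fun τ : X ≃ₜ X => ⇑τ) rfl fun _ _ => rfl]

theorem exists_crossingSet_eq_univ [CompactSpace X]
    (hy : ∀ x, y ∈ closure (Set.range fun k : ℤ => (σ ^ k) x)) {Y : Set X} (hY : Y ∈ 𝓝 y) :
    ∃ N : ℕ, crossingSet σ Y N = Set.univ := by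
  have isOpen_preimage (k : ℤ) : IsOpen ((σ ^ k : X ≃ₜ X) ⁻¹' interior Y) :=
    isOpen_interior.preimage (σ ^ k : X ≃ₜ X).continuous
  have univ_subset : Set.univ ⊆ ⋃ k : ℤ, (σ ^ k : X ≃ₜ X) ⁻¹' interior Y := fun x _ => by
    obtain ⟨_, hz, k, rfl⟩ := mem_closure_iff_nhds.mp (hy x) _ (interior_mem_nhds.mpr hY)
    exact Set.mem_iUnion.mpr ⟨k, hz⟩
  obtain ⟨t, ht⟩ := isCompact_univ.elim_finite_subcover _ isOpen_preimage univ_subset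
  let M := t.sup Int.natAbs
  refine ⟨2 * M + 1, Set.eq_univ_of_forall fun x => ?_⟩
  obtain ⟨k, hk, hkx⟩ : ∃ k ∈ t, (σ ^ k) ((σ ^ (M : ℤ)) x) ∈ interior Y := by
    simpa using ht (Set.mem_univ ((σ ^ (M : ℤ)) x))
  have natAbs_le : k.natAbs ≤ M := Finset.le_sup (f := Int.natAbs) hk
  refine ⟨k + M, ⟨by omega, by omega⟩, ?_⟩
  rw [zpow_add_apply]
  exact interior_subset hkx

theorem exists_nhds_forall_zpow_notMem [T2Space X] (hy : y ∉ Function.periodicPts σ) (J : ℕ) :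
    ∃ B ∈ 𝓝 y, ∀ k ∈ Set.Ioc 0 J, ∀ x ∈ B, (σ ^ (k : ℤ)) x ∉ B := by
  have exists_nhds (k : ℕ) (hk : k ∈ Set.Ioc 0 J) : ∃ B ∈ 𝓝 y, ∀ x ∈ B, (σ ^ (k : ℤ)) x ∉ B := by
    have zpow_apply_ne : (σ ^ (k : ℤ)) y ≠ y := fun h =>
      hy ⟨k, hk.1, (zpow_natCast_apply σ k y).symm.trans h⟩
    obtain ⟨U, V, hU, hV, hUV⟩ := t2_separation_nhds zpow_apply_ne
    exact ⟨V ∩ (σ ^ (k : ℤ) : X ≃ₜ X) ⁻¹' U, Filter.inter_mem hV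
      ((σ ^ (k : ℤ) : X ≃ₜ X).continuous.continuousAt hU),
      fun x hx hx' => Set.disjoint_left.mp hUV hx.2 hx'.1⟩
  choose! B hB hBk using exists_nhds
  refine ⟨⋂ k ∈ Set.Ioc 0 J, B k, (Filter.biInter_mem (Set.finite_Ioc 0 J)).mpr hB,
    fun k hk x hx hx' => ?_⟩
  exact hBk k hk x (Set.mem_iInter₂.mp hx k hk) (Set.mem_iInter₂.mp hx' k hk)

namespace IsMinimalHomeo

theorem closure_range_zpow_apply (hσ : IsMinimalHomeo σ) (x : X) :
    closure (Set.range fun k : ℤ => (σ ^ k) x) = Set.univ := by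
  have image_range :
      σ '' Set.range (fun k : ℤ => (σ ^ k) x) = Set.range fun k : ℤ => (σ ^ k) x := by
    have apply_zpow_apply (k : ℤ) : σ ((σ ^ k) x) = (σ ^ (1 + k)) x := by
      rw [zpow_add_apply, zpow_one]
    rw [← Set.range_comp, Function.comp_def]
    simp only [apply_zpow_apply]
    exact (Equiv.addLeft (1 : ℤ)).surjective.range_comp fun k => (σ ^ k) x
  refine (hσ _ isClosed_closure (by rw [σ.image_closure, image_range])).resolve_left ?_
  exact (Set.range_nonempty _).closure.ne_empty

theorem notMem_periodicPts [T1Space X] [Infinite X] (hσ : IsMinimalHomeo σ) (y : X) :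
    y ∉ Function.periodicPts σ := by
  rintro ⟨n, hn, hy⟩
  have periodic : Function.Periodic (fun k : ℤ => (σ ^ k) y) n := fun k => by
    simp only [zpow_add_apply, zpow_natCast_apply, hy.eq]
  have range_finite : (Set.range fun k : ℤ => (σ ^ k) y).Finite := by
    rw [← periodic.image_Ioc (by exact_mod_cast hn) 0]
    exact (Set.finite_Ioc _ _).image _
  have range_eq_univ := hσ.closure_range_zpow_apply y
  rw [range_finite.isClosed.closure_eq] at range_eq_univ
  exact Set.infinite_univ (range_eq_univ ▸ range_finite)

end IsMinimalHomeo

end Dynamics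

section DimRatio

variable {X : Type*} [TopologicalSpace X] {σ : X ≃ₜ X} {A : Type u} [CStarAlgebra A]
  {P : CovariantPair σ A} {Y : Set X}

namespace IrrRep.IsOrbitBasis

variable {S : StarSubalgebra ℂ A} {ρ : IrrRep S} {x : X} {δ : ℕ}
  {b : OrthonormalBasis (Fin (δ + 1)) ℂ ρ.H}

theorem lt_of_crossingSet_eq_univ (hb : IsOrbitBasis P Y ρ x b) {N : ℕ}
    (hN : crossingSet σ Y N = Set.univ) : δ < N := by
  obtain ⟨k, ⟨hk₀, hkN⟩, hk⟩ : x ∈ crossingSet σ Y N := hN ▸ Set.mem_univ x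
  lift k to ℕ using by omega
  by_contra! hle
  exact hb.notMem k (by omega) hk

theorem le_of_forall_zpow_notMem (hb : IsOrbitBasis P Y ρ x b) {J : ℕ}
    (hJ : ∀ k ∈ Set.Ioc 0 J, ∀ x ∈ Y, (σ ^ (k : ℤ)) x ∉ Y) : J ≤ δ := by
  by_contra! hlt
  refine hJ (δ + 1) ⟨δ.succ_pos, hlt⟩ _ hb.pred_mem ?_
  rw [← zpow_add_apply, Nat.cast_succ, add_neg_cancel_right]
  exact hb.last_mem

end IrrRep.IsOrbitBasis

variable [CompactSpace X] {κ : Type*} {ψ : κ → C(X, ℂ)} {i₀ : κ}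

theorem IrrRep.exists_hasDim_generatedBy (hY : ∀ x, x ∈ Y ↔ ψ i₀ x = 0) {N J : ℕ}
    (hN : crossingSet σ Y N = Set.univ) (hJ : ∀ k ∈ Set.Ioc 0 J, ∀ x ∈ Y, (σ ^ (k : ℤ)) x ∉ Y)
    (ρ : IrrRep (P.generatedBy ψ i₀)) : ∃ d ∈ Set.Ioc J N, ρ.HasDim d := by
  obtain ⟨x, δ, b, hb⟩ := exists_isOrbitBasis_generatedBy hY hN ρ
  have J_le := hb.le_of_forall_zpow_notMem hJ
  have lt_N := hb.lt_of_crossingSet_eq_univ hN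
  exact ⟨δ + 1, ⟨by omega, lt_N⟩, hasDim_of_orthonormalBasis b⟩

theorem dimRatio_generatedBy_le [Finite κ] (hY : ∀ x, x ∈ Y ↔ ψ i₀ x = 0) {N : ℕ}
    (hN : crossingSet σ Y N = Set.univ) :
    dimRatio (P.generatedBy ψ i₀) ≤ (2 * Nat.card κ : ℕ) := by
  refine iSup₂_le fun d _ => ENNReal.div_le_of_le_mul ?_
  have coveringDim_le : coveringDim (primOfDim (P.generatedBy ψ i₀) d) ≤
      (2 * (Nat.card κ * d) : ℕ) :=
    iInf₂_le _ (IrrRep.coveringDimLE_primOfDim_generatedBy hY hN d)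
  rw [← Nat.cast_mul, mul_assoc]
  exact_mod_cast ENat.toENNReal_le.mpr coveringDim_le

end DimRatio

/-! ### Orbit breaking in the crossed product -/

namespace CrossedProduct

variable {X : Type u} [TopologicalSpace X] [CompactSpace X]

/-- The canonical covariant pair of the crossed product. -/
def covariantPair (σ : X ≃ₜ X) : CovariantPair σ (CrossedProduct σ) where
  π := ofFun σ
  U := ⟨u σ, u_mem_unitary σ⟩
  covariant f := by
    rw [← CrossedProduct.covariant, mul_assoc, (u_mem_unitary σ).1, mul_one]

theorem generatedBy_le_orbitBreaking (σ : X ≃ₜ X) {κ : Type*} {ψ : κ → C(X, ℂ)} {i₀ : κ}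
    {Y : Set X} (hY : ∀ x ∈ Y, ψ i₀ x = 0) :
    (covariantPair σ).generatedBy ψ i₀ ≤ orbitBreaking σ Y := by
  refine StarSubalgebra.topologicalClosure_mono (StarAlgebra.adjoin_le ?_)
  rintro _ (⟨i, rfl⟩ | rfl)
  · exact StarAlgebra.subset_adjoin ℂ _ (Or.inl ⟨_, rfl⟩)
  · exact StarAlgebra.subset_adjoin ℂ _ (Or.inr ⟨_, hY, rfl⟩)

end CrossedProduct

theorem exists_eventuallyEq_zero_eqOn_one_compl {X : Type*} [TopologicalSpace X] [CompactSpace X]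
    [T2Space X] {y : X} {V : Set X} (hV : V ∈ 𝓝 y) :
    ∃ h : C(X, ℂ), h =ᶠ[𝓝 y] 0 ∧ Set.EqOn h 1 Vᶜ := by
  obtain ⟨K, hK, K_isClosed, hKV⟩ := exists_mem_nhds_isClosed_subset (interior_mem_nhds.mpr hV)
  obtain ⟨F, hF₀, hF₁, -⟩ := exists_continuous_zero_one_of_isClosed K_isClosed
    isOpen_interior.isClosed_compl (Set.disjoint_compl_right_iff_subset.mpr hKV)
  refine ⟨F.realToRCLike ℂ, Filter.mem_of_superset hK fun x hx => ?_, fun x hx => ?_⟩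
  · simp [hF₀ hx]
  · simp [hF₁ fun h => hx (interior_subset h)]

theorem exists_cutoff_forall_zpow_ne_zero {X : Type*} [TopologicalSpace X] [CompactSpace X]
    [T2Space X] {σ : X ≃ₜ X} {y : X} (hy : y ∉ Function.periodicPts σ) {W : Set X} (hW : W ∈ 𝓝 y)
    (J : ℕ) : ∃ h : C(X, ℂ), h =ᶠ[𝓝 y] 0 ∧ Set.EqOn h 1 Wᶜ ∧
      ∀ k ∈ Set.Ioc 0 J, ∀ x, h x = 0 → h ((σ ^ (k : ℤ)) x) ≠ 0 := by
  obtain ⟨B, hB, hBJ⟩ := exists_nhds_forall_zpow_notMem hy J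
  obtain ⟨h, hhy, h_eqOn⟩ := exists_eventuallyEq_zero_eqOn_one_compl (Filter.inter_mem hB hW)
  have mem_of_eq_zero (x : X) (hx : h x = 0) : x ∈ B := by
    by_contra hxB
    exact one_ne_zero ((h_eqOn fun hxV => hxB hxV.1).symm.trans hx)
  exact ⟨h, hhy, h_eqOn.mono (Set.compl_subset_compl.mpr Set.inter_subset_right),
    fun k hk x hx hx' => hBJ k hk x (mem_of_eq_zero x hx) (mem_of_eq_zero _ hx')⟩

theorem theorem5p1_general {X : Type u} [TopologicalSpace X] [CompactSpace X] [T2Space X]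
    (σ : X ≃ₜ X) {y : X} (hy : y ∉ Function.periodicPts σ)
    (hσ : ∀ x, y ∈ closure (Set.range fun k : ℤ => (σ ^ k) x)) {W : Set X} (hW : W ∈ 𝓝 y)
    {ι κ : Type*} [Finite ι] [Finite κ] (f : ι → C(X, ℂ)) (g : κ → C(X, ℂ))
    (hg : ∀ j, ∀ x ∈ W, g j x = 0) (J : ℕ) :
    ∃ Y : Set X, IsClosed Y ∧ Y ∈ 𝓝 y ∧ Y ⊆ W ∧
    ∃ S : StarSubalgebra ℂ (CrossedProduct σ),
      IsClosed (S : Set (CrossedProduct σ)) ∧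
      S ≤ CrossedProduct.orbitBreaking σ Y ∧
      (∀ i, CrossedProduct.ofFun σ (f i) ∈ S) ∧
      (∀ j, CrossedProduct.u σ * CrossedProduct.ofFun σ (g j) ∈ S) ∧
      IsSubhomogeneous S ∧
      dimRatio S ≤ (2 * (Nat.card ι + Nat.card κ + 1) : ℕ) ∧
      ∀ ρ : IrrRep S, ∀ d : ℕ, ρ.HasDim d → J ≤ d := by
  obtain ⟨h, hY, h_eqOn, hJ⟩ := exists_cutoff_forall_zpow_ne_zero hy hW J
  let Y : Set X := {x | h x = 0}
  have Y_subset : Y ⊆ W := fun x hx => by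
    by_contra hxW
    exact one_ne_zero ((h_eqOn hxW).symm.trans hx)
  obtain ⟨N, hN⟩ := exists_crossingSet_eq_univ hσ hY
  have mem_iff (x : X) : x ∈ Y ↔ h x = 0 := Iff.rfl
  let P := CrossedProduct.covariantPair σ
  let ψ : Option (ι ⊕ κ) → C(X, ℂ) := fun o => o.elim h (Sum.elim f g)
  have exists_hasDim :=
    IrrRep.exists_hasDim_generatedBy (P := P) (ψ := ψ) (i₀ := none) mem_iff hN hJ
  refine ⟨Y, isClosed_eq h.continuous continuous_const, hY, Y_subset,
    P.generatedBy ψ none, inferInstance, CrossedProduct.generatedBy_le_orbitBreaking σ fun _ => id,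
    fun i => P.map_mem_generatedBy ψ none (some (Sum.inl i)), fun j => ?_, ⟨N, fun ρ => ?_⟩, ?_,
    fun ρ d hd => ?_⟩
  · have mul_eq : h * g j = g j := by
      ext x
      by_cases hx : x ∈ W
      · simp [hg j x hx]
      · simp [h_eqOn hx]
    rw [← mul_eq, map_mul, ← mul_assoc]
    exact mul_mem (P.mul_map_mem_generatedBy ψ none)
      (P.map_mem_generatedBy ψ none (some (Sum.inr j)))
  · obtain ⟨d, hd, hρ⟩ := exists_hasDim ρ
    exact ⟨d, hd.2, hρ⟩
  · simpa using dimRatio_generatedBy_le (P := P) (ψ := ψ) (i₀ := none) mem_iff hN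
  · obtain ⟨d', hd', hρ⟩ := exists_hasDim ρ
    exact hρ.unique hd ▸ hd'.1.le

end

theorem theorem5p1 {X : Type u} [TopologicalSpace X] [CompactSpace X]
    [TopologicalSpace.MetrizableSpace X] [Infinite X]
    (σ : X ≃ₜ X) (hσ : IsMinimalHomeo σ) (y : X) (W : Set X) (hW : IsOpen W) (hy : y ∈ W)
    {n m : ℕ} (f : Fin n → C(X, ℂ)) (g : Fin m → C(X, ℂ))
    (hg : ∀ j, ∀ x ∈ W, g j x = 0) (ε : ℝ) (hε : 0 < ε) :
    ∃ R : ℝ, 0 < R ∧ ∀ J : ℕ,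
      ∃ Y : Set X, IsClosed Y ∧ Y ∈ 𝓝 y ∧ Y ⊆ W ∧
      ∃ S : StarSubalgebra ℂ (CrossedProduct σ),
        IsClosed (S : Set (CrossedProduct σ)) ∧
        S ≤ CrossedProduct.orbitBreaking σ Y ∧
        (∀ i, ∃ s ∈ S, ‖CrossedProduct.ofFun σ (f i) - s‖ < ε) ∧
        (∀ j, ∃ s ∈ S, ‖CrossedProduct.u σ * CrossedProduct.ofFun σ (g j) - s‖ < ε) ∧
        IsSubhomogeneous S ∧
        dimRatio S ≤ ENNReal.ofReal R ∧
        ∀ ρ : IrrRep S, ∀ d : ℕ, ρ.HasDim d → J ≤ d := by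
  refine ⟨(2 * (Nat.card (Fin n) + Nat.card (Fin m) + 1) : ℕ), by positivity, fun J => ?_⟩
  obtain ⟨Y, Y_isClosed, hY, hYW, S, S_isClosed, hSY, hf, hg, hS, hR, hJ⟩ :=
    theorem5p1_general σ (hσ.notMem_periodicPts y)
      (fun x => hσ.closure_range_zpow_apply x ▸ Set.mem_univ y) (hW.mem_nhds hy) f g hg J
  exact ⟨Y, Y_isClosed, hY, hYW, S, S_isClosed, hSY, fun i => ⟨_, hf i, by simpa using hε⟩,
    fun j => ⟨_, hg j, by simpa using hε⟩, hS, hR.trans_eq (ENNReal.ofReal_natCast _).symm, hJ⟩
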